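/- Groupoids are presented by their sets of arrows $\mathcal G$, with unit space $\mathcal G^{(0)}\subset\mathcal G$, source map $s(\gamma)=\gamma^{-1}\gamma$ and range map $r(\gamma)=\gamma\gamma^{-1}$. Let $\mathcal G$ be a locally compact Hausdorff étale groupoid (i.e. product and inverse are continuous and $r:\mathcal G\to\mathcal G$ is a local homeomorphism) whose unit space is compact and metrizable. Write $AB=\{\alpha\beta:\alpha\in A,\ \beta\in B \text{ composable}\}$. Definitions. * $\mathcal G$ is minimal if the only closed sets $D\subset\mathcal G^{(0)}$ with $r(\mathcal G D)=D$ are $\emptyset$ and $\mathcal G^{(0)}$. * A bisection is a subset of an open set $U\subset\mathcal G$ such that $s|_U$ and $r|_U$ are homeomorphisms onto open subsets of $\mathcal G^{(0)}$. $M(\mathcal G)$ is the set of regular Borel probability measures $\mu$ on $\mathcal G^{(0)}$ with $\mu(r(B))=\mu(s(B))$ for every Borel bisection $B$. * For $K\subset\mathcal G^{(0)}$ compact and $V\subset\mathcal G^{(0)}$ open, $K\prec_{\mathcal G}V$ means that there are open bisections $A_1,\dots,A_n$ with $K\subset\bigcup_i s(A_i)$ such that the sets $r(A_i)$ are pairwise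 disjoint and contained in $V$. For $U,V\subset\mathcal G^{(0)}$ open, $U\precsim_{\mathcal G}V$ means $K\prec_{\mathcal G}V$ for every compact $K\subset U$. * $\mathcal G$ has groupoid strict comparison if, for all open $U,V\subset\mathcal G^{(0)}$ with $V\neq\emptyset$, one has $U\precsim_{\mathcal G}V$ whenever $\mu(U)<\mu(V)$ for all $\mu\in M(\mathcal G)$. * An open castle is a family $\{C^l_{i,j}: i,j\in F_l,\ l\in I\}$ of open bisections, with finite index sets $I$ and $F_l$, such that $C^l_{i,j}C^l_{j,k}=C^l_{i,k}$, for each $l$ the levels $C^l_{i,i}$ ($i\in F_l$) are pairwise disjoint subsets of $\mathcal G^{(0)}$, and $C^l_{i,j}C^{l'}_{i',j'}=\emptyset$ for $l\ne l'$. It is $K$-extendable to an open castle $\{D^l_{i,j}:i,j\in E_l,\ l\in I\}$ if $F_l\subset E_l$, $C^l_{i,j}=D^l_{i,j}$ for $i,j\in F_l$, and $K\cdot\bigcup_{l,i,j}C^l_{i,j}\subset\bigcup_{l,i,j}D^l_{i,j}$. * $\mathcal G$ is almost elementary if for every compact $K$ with $\mathcal G^{(0)}\subset K\subset\mathcal G$,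 every nonempty open $O\subset\mathcal G^{(0)}$ and every open cover $\mathcal V$ of $\mathcal G^{(0)}$ there are open castles $\{C^l_{i,j}:i,j\in F_l,\ l\in I\}$ and $\{D^l_{i,j}:i,j\in E_l,\ l\in I\}$ such that the first is $K$-extendable to the second, each $D^l_{i,i}$ lies in some member of $\mathcal V$, and $\mathcal G^{(0)}\setminus\bigcup_{l\in I,\,i\in F_l}C^l_{i,i}\prec_{\mathcal G}O$. * $\mathcal G$ is fiberwise amenable if for every compact $K\subset\mathcal G$ and $\varepsilon>0$ there is a nonempty finite set $A\subset\mathcal G$ with $|\partial_KA|\le\varepsilon|A|$, where $\partial_KA=(KA\setminus A)\cup\{x\in A: yx\notin A\text{ for some }y\in K\text{ composable with }x\}$. Theorem. Suppose that $\mathcal G$ is minimal and almost elementary. Then $\mathcal G$ has groupoid strict comparison. If moreover $\mathcal G^{(0)}$ is infinite and $\mathcal G$ is not fiberwise amenable, then $U\precsim_{\mathcal G}O$ for all open $U,O\subset\mathcal G^{(0)}$ with $O\neq\emptyset$, and $M(\mathcal G)=\emptyset$. -/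

import Mathlib

open Set Topology MeasureTheory

namespace EtaleGpd

universe u

/-- A groupoid, presented by its set `G` of arrows: a set `comp` of composable pairs, a product
defined on composable pairs and an inverse map. The product is written as a total function, but
no law constrains (and no later definition uses) its values outside `comp`. -/
class Gpd (G : Type u) where
  /-- the set of composable pairs -/
  comp : Set (G × G)
  /-- the product map, meaningful on `comp` only -/
  mul : G → G → G
  /-- the inverse map -/
  inv : G → G
  comp_mul_left : ∀ a b c, (a, b) ∈ comp → (b, c) ∈ comp → (mul a b, c) ∈ comp
  comp_mul_right : ∀ a b c, (a, b) ∈ comp → (b, c) ∈ comp → (a, mul b c) ∈ comp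
  mul_assoc : ∀ a b c, (a, b) ∈ comp → (b, c) ∈ comp → mul (mul a b) c = mul a (mul b c)
  comp_inv : ∀ a, (a, inv a) ∈ comp
  inv_inv : ∀ a, inv (inv a) = a
  inv_mul_cancel_left : ∀ a b, (a, b) ∈ comp → mul (inv a) (mul a b) = b
  mul_inv_cancel_right : ∀ a b, (a, b) ∈ comp → mul (mul a b) (inv b) = a

/-- The unit space `{γ γ⁻¹ : γ ∈ G}` of a groupoid. -/
def UnitSpace (G : Type u) [Gpd G] : Type u :=
  {x : G // ∃ g : G, x = Gpd.mul g (Gpd.inv g)}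

section Algebra

variable {G : Type u} [Gpd G]

/-- A unit, seen as an arrow. -/
def UnitSpace.val (x : UnitSpace G) : G := Subtype.val x

/-- The range map `r(γ) = γ γ⁻¹`. -/
def rng (g : G) : UnitSpace G := ⟨Gpd.mul g (Gpd.inv g), g, rfl⟩

/-- The source map `s(γ) = γ⁻¹ γ`. -/
def src (g : G) : UnitSpace G :=
  ⟨Gpd.mul (Gpd.inv g) g, Gpd.inv g, by rw [Gpd.inv_inv]⟩

/-- The product `A B = {α β : α ∈ A, β ∈ B, (α, β) composable}` of two sets of arrows. -/
def setMul (A B : Set G) : Set G :=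
  {g | ∃ a ∈ A, ∃ b ∈ B, (a, b) ∈ Gpd.comp ∧ g = Gpd.mul a b}

/-- The left outer `K`-boundary `(K A) \ A`. -/
def outerBoundary (K A : Set G) : Set G := setMul K A \ A

/-- The left inner `K`-boundary `{x ∈ A : y x ∉ A for some y ∈ K composable with x}`. -/
def innerBoundary (K A : Set G) : Set G :=
  {x | x ∈ A ∧ ∃ y ∈ K, (y, x) ∈ Gpd.comp ∧ Gpd.mul y x ∉ A}

/-- The left `K`-boundary. -/
def boundary (K A : Set G) : Set G := outerBoundary K A ∪ innerBoundary K A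

/-- A nonempty finite set `A` of arrows is `(K, ε)`-Følner if `|∂_K A| / |A| ≤ ε`. -/
def IsFolner (K : Set G) (ε : ℝ) (A : Finset G) : Prop :=
  A.Nonempty ∧ (boundary K (A : Set G)).Finite ∧
    ((boundary K (A : Set G)).ncard : ℝ) / (A.card : ℝ) ≤ ε

/-- A set `D` of units is invariant if `r(G D) = D`, where `G D = s⁻¹(D)`. -/
def IsInvariant (D : Set (UnitSpace G)) : Prop :=
  (rng : G → UnitSpace G) '' ((src : G → UnitSpace G) ⁻¹' D) = D

end Algebra

/-- The unit space carries the topology induced from the arrows. -/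
instance (G : Type u) [Gpd G] [TopologicalSpace G] : TopologicalSpace (UnitSpace G) :=
  TopologicalSpace.induced UnitSpace.val inferInstance

/-- The unit space carries its Borel σ-algebra. -/
instance (G : Type u) [Gpd G] [TopologicalSpace G] : MeasurableSpace (UnitSpace G) :=
  borel (UnitSpace G)

instance (G : Type u) [Gpd G] [TopologicalSpace G] : BorelSpace (UnitSpace G) := ⟨rfl⟩

/-- Topological groupoid: the product (on composable pairs) and the inverse are continuous. -/
structure IsTopologicalGpd (G : Type u) [Gpd G] [TopologicalSpace G] : Prop where
  continuousOn_mul : ContinuousOn (fun p : G × G => Gpd.mul p.1 p.2) Gpd.comp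
  continuous_inv : Continuous (Gpd.inv : G → G)

/-- Étale: the range map is a local homeomorphism from `G` to itself. -/
def IsEtale (G : Type u) [Gpd G] [TopologicalSpace G] : Prop :=
  IsLocalHomeomorph (fun g : G => (rng g).val)

/-- Minimal: the only closed invariant sets of units are the empty set and the unit space. -/
def IsMinimal (G : Type u) [Gpd G] [TopologicalSpace G] : Prop :=
  ∀ D : Set (UnitSpace G), IsClosed D → IsInvariant D → D = ∅ ∨ D = univ

/-- Fiberwise amenable: there are `(K, ε)`-Følner sets for all compact `K` and all `ε > 0`. -/
def FiberwiseAmenable (G : Type u) [Gpd G] [TopologicalSpace G] : Prop :=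
  ∀ K : Set G, IsCompact K → ∀ ε : ℝ, 0 < ε → ∃ A : Finset G, IsFolner K ε A

section Topology

variable {G : Type u} [Gpd G] [TopologicalSpace G]

/-- A bisection: a subset of an open set `U` on which source and range restrict to homeomorphisms
onto open subsets of the unit space. -/
def IsBisection (B : Set G) : Prop :=
  ∃ U : Set G, IsOpen U ∧ B ⊆ U ∧
    IsOpenEmbedding (U.domRestrict (src : G → UnitSpace G)) ∧
    IsOpenEmbedding (U.domRestrict (rng : G → UnitSpace G))

/-- The relation `K ≺ V` (used for `K` compact and `V` open in the unit space). -/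
def CompactSub (K V : Set (UnitSpace G)) : Prop :=
  ∃ (n : ℕ) (A : Fin n → Set G),
    (∀ i, IsOpen (A i) ∧ IsBisection (A i)) ∧
    K ⊆ ⋃ i, src '' A i ∧
    Pairwise (fun i j => Disjoint (rng '' A i) (rng '' A j)) ∧
    ⋃ i, rng '' A i ⊆ V

/-- The relation `U ≾ V` (used for `U`, `V` open in the unit space). -/
def OpenSub (U V : Set (UnitSpace G)) : Prop :=
  ∀ K : Set (UnitSpace G), IsCompact K → K ⊆ U → CompactSub K V

/-- A multisection `{C i j : i, j ∈ F}`. Only the values `C i j` with `i, j ∈ F` matter. -/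
structure IsMultisection (F : Finset ℕ) (C : ℕ → ℕ → Set G) : Prop where
  isBisection : ∀ i ∈ F, ∀ j ∈ F, IsBisection (C i j)
  mul_eq : ∀ i ∈ F, ∀ j ∈ F, ∀ k ∈ F, setMul (C i j) (C j k) = C i k
  level_subset : ∀ i ∈ F, C i i ⊆ range (UnitSpace.val : UnitSpace G → G)
  level_disjoint : ∀ i ∈ F, ∀ j ∈ F, i ≠ j → Disjoint (C i i) (C j j)

/-- A castle `{C l i j : i, j ∈ F l, l ∈ I}` with `I = {0, …, n - 1}`, all of whose bisections are
open. -/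
structure IsOpenCastle {n : ℕ} (F : Fin n → Finset ℕ) (C : Fin n → ℕ → ℕ → Set G) : Prop where
  isMultisection : ∀ l, IsMultisection (F l) (C l)
  mul_eq_empty : ∀ l l', l ≠ l' → ∀ i ∈ F l, ∀ j ∈ F l, ∀ i' ∈ F l', ∀ j' ∈ F l',
    setMul (C l i j) (C l' i' j') = ∅
  isOpen : ∀ l, ∀ i ∈ F l, ∀ j ∈ F l, IsOpen (C l i j)

/-- The union of all the bisections of a castle. -/
def castleUnion {n : ℕ} (F : Fin n → Finset ℕ) (C : Fin n → ℕ → ℕ → Set G) : Set G :=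
  {g | ∃ l, ∃ i ∈ F l, ∃ j ∈ F l, g ∈ C l i j}

/-- The set of units lying in some level of a castle. -/
def castleLevels {n : ℕ} (F : Fin n → Finset ℕ) (C : Fin n → ℕ → ℕ → Set G) :
    Set (UnitSpace G) :=
  {x | ∃ l, ∃ i ∈ F l, x.val ∈ C l i i}

/-- The castle `C` (indexed by `F`) is `K`-extendable to the castle `D` (indexed by `E`): it is a
sub-castle of `D` and `K · ⊔ C ⊆ ⊔ D`. -/
structure ExtendsTo (K : Set G) {n : ℕ} (F : Fin n → Finset ℕ) (C : Fin n → ℕ → ℕ → Set G)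
    (E : Fin n → Finset ℕ) (D : Fin n → ℕ → ℕ → Set G) : Prop where
  index_subset : ∀ l, F l ⊆ E l
  eq_of_mem : ∀ l, ∀ i ∈ F l, ∀ j ∈ F l, C l i j = D l i j
  mul_subset : setMul K (castleUnion F C) ⊆ castleUnion E D

end Topology

/-- Almost elementary groupoid (with compact unit space). -/
def AlmostElementary (G : Type u) [Gpd G] [TopologicalSpace G] : Prop :=
  ∀ K : Set G, IsCompact K → range (UnitSpace.val : UnitSpace G → G) ⊆ K →
  ∀ O : Set (UnitSpace G), IsOpen O → O.Nonempty →
  ∀ 𝒱 : Set (Set (UnitSpace G)), (∀ V ∈ 𝒱, IsOpen V) → ⋃₀ 𝒱 = univ →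
  ∃ (n : ℕ) (F E : Fin n → Finset ℕ) (C D : Fin n → ℕ → ℕ → Set G),
    IsOpenCastle F C ∧ IsOpenCastle E D ∧
    ExtendsTo K F C E D ∧
    (∀ l, ∀ i ∈ E l, ∃ V ∈ 𝒱, D l i i ⊆ UnitSpace.val '' V) ∧
    CompactSub (castleLevels F C)ᶜ O

/-- The set `M(G)` of invariant regular Borel probability measures on the unit space; invariance
means `μ(r(B)) = μ(s(B))` for every Borel bisection `B`. -/
def invariantMeasures (G : Type u) [Gpd G] [TopologicalSpace G] : Set (Measure (UnitSpace G)) :=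
  {μ | IsProbabilityMeasure μ ∧ μ.Regular ∧
    ∀ B : Set G, MeasurableSet[borel G] B → IsBisection B → μ (rng '' B) = μ (src '' B)}

/-- Groupoid strict comparison: `U ≾ V` whenever `U`, `V` are open sets of units, `V` is nonempty
and `μ(U) < μ(V)` for all invariant `μ`. If there is an invariant measure, then `V` is
automatically nonempty; if there is none, then the condition on measures is void and nonemptiness
of `V` is what remains. -/
def HasStrictComparison (G : Type u) [Gpd G] [TopologicalSpace G] : Prop :=
  ∀ U V : Set (UnitSpace G), IsOpen U → IsOpen V → V.Nonempty →
    (∀ μ ∈ invariantMeasures G, μ U < μ V) → OpenSub U V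

end EtaleGpd

/-! For a finite set `A` of arrows, let `hits A Y` count the elements with range in `Y`. Normalised,
this is an empirical measure on units, and along ever better Følner sets its weak limits are
invariant. So if every invariant measure gives `U` less mass than `V`, a compactness argument yields
a uniform gap: sufficiently invariant Følner sets hit a compact part of `V` more often than a
neighbourhood of `K ⊆ U`, by a fixed proportion (`exists_isFolner_hits_add_le`).

Almost elementarity turns such counts into subequivalence (`compactSub_of_isFolner_hits`). In a
tower of the inner castle, let `A` be the column of arrows over one unit. Multiply `A` repeatedly by
a compact set of arrows. Either some stage is Følner, and the gap compares hits; or the set keeps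
growing by a fixed factor, and minimality then makes its next multiple hit a prescribed open part of
`V` at least `|A|` times. Extendability keeps all these arrows in the outer castle, whose levels
over `V` are therefore at least as many as the inner levels meeting `K`
(`IsOpenCastle.card_meeting_le`). Matching levels, and sending the uncovered remainder into a small
reserved open piece of `V`, gives `K ≺ V` (`IsOpenCastle.compactSub`).

Without fiberwise amenability the Følner alternative never occurs for a suitable pair `(K₀, ε)`, so
the gap hypothesis is vacuous and every compact set is subequivalent to every nonempty open set. Two
disjoint open sets would then each have full mass, so no invariant measure exists. A finite unit
space is treated separately, by counting points. -/

namespace EtaleGpd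

universe u

/-! ### Groupoid identities and monotonicity of the Følner condition. -/

section Algebra

variable {G : Type u} [Gpd G]

lemma val_injective : Function.Injective (UnitSpace.val : UnitSpace G → G) :=
  Subtype.val_injective

lemma inv_comp (a : G) : (Gpd.inv a, a) ∈ Gpd.comp := by
  simpa [Gpd.inv_inv] using Gpd.comp_inv (Gpd.inv a)

/-- Bracketing `a⁻¹ (a b) b⁻¹` in two ways gives `b b⁻¹ = a⁻¹ a`. Conversely, `a (a⁻¹ a)` is
composable with `b` when `a⁻¹ a = b b⁻¹`, and it equals `a`. -/
lemma comp_iff {a b : G} : (a, b) ∈ Gpd.comp ↔ src a = rng b := by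
  constructor
  · intro h
    apply Subtype.ext
    change Gpd.mul (Gpd.inv a) a = Gpd.mul b (Gpd.inv b)
    have h1 : (Gpd.inv a, Gpd.mul a b) ∈ Gpd.comp := Gpd.comp_mul_right _ _ _ (inv_comp a) h
    have h2 : (Gpd.mul a b, Gpd.inv b) ∈ Gpd.comp := Gpd.comp_mul_left _ _ _ h (Gpd.comp_inv b)
    have h3 := Gpd.mul_assoc _ _ _ h1 h2
    rw [Gpd.inv_mul_cancel_left a b h, Gpd.mul_inv_cancel_right a b h] at h3
    exact h3.symm
  · intro h
    have h : Gpd.mul (Gpd.inv a) a = Gpd.mul b (Gpd.inv b) := congrArg Subtype.val h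
    have h1 : (a, Gpd.mul (Gpd.inv a) a) ∈ Gpd.comp :=
      Gpd.comp_mul_right _ _ _ (Gpd.comp_inv a) (inv_comp a)
    have h2 : (Gpd.mul (Gpd.inv a) a, b) ∈ Gpd.comp := by
      rw [h]
      exact Gpd.comp_mul_left _ _ _ (Gpd.comp_inv b) (inv_comp b)
    have h3 := Gpd.comp_mul_left _ _ _ h1 h2
    have h4 := Gpd.inv_mul_cancel_left (Gpd.inv a) a (inv_comp a)
    rw [Gpd.inv_inv] at h4
    rwa [h4] at h3

lemma src_inv (a : G) : src (Gpd.inv a) = rng a := comp_iff.1 (inv_comp a)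

lemma rng_inv (a : G) : rng (Gpd.inv a) = src a := (comp_iff.1 (Gpd.comp_inv a)).symm

lemma src_mul {a b : G} (h : src a = rng b) : src (Gpd.mul a b) = src b := by
  have h := comp_iff.2 h
  have h2 : (Gpd.mul a b, Gpd.inv b) ∈ Gpd.comp := Gpd.comp_mul_left _ _ _ h (Gpd.comp_inv b)
  rw [comp_iff.1 h2, rng_inv]

lemma rng_mul {a b : G} (h : src a = rng b) : rng (Gpd.mul a b) = rng a := by
  have h := comp_iff.2 h
  have h1 : (Gpd.inv a, Gpd.mul a b) ∈ Gpd.comp := Gpd.comp_mul_right _ _ _ (inv_comp a) h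
  rw [← comp_iff.1 h1, src_inv]

lemma mul_left_cancel {a b c : G} (hb : src a = rng b) (hc : src a = rng c)
    (h : Gpd.mul a b = Gpd.mul a c) : b = c := by
  rw [← Gpd.inv_mul_cancel_left a b (comp_iff.2 hb), h,
    Gpd.inv_mul_cancel_left a c (comp_iff.2 hc)]

lemma inv_mul_mul {a b : G} (h : src a = rng b) : Gpd.mul (Gpd.inv a) (Gpd.mul a b) = b :=
  Gpd.inv_mul_cancel_left a b (comp_iff.2 h)

lemma mul_mul_assoc {a b c : G} (h : src a = rng b) (h' : src b = rng c) :
    Gpd.mul (Gpd.mul a b) c = Gpd.mul a (Gpd.mul b c) :=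
  Gpd.mul_assoc a b c (comp_iff.2 h) (comp_iff.2 h')

lemma rng_val (x : UnitSpace G) : rng x.val = x := by
  obtain ⟨_, g, rfl⟩ := x
  exact rng_mul (rng_inv g).symm

lemma src_val (x : UnitSpace G) : src x.val = x := by
  obtain ⟨_, g, rfl⟩ := x
  exact (src_mul (rng_inv g).symm).trans (src_inv g)

lemma val_mul (b : G) : Gpd.mul (rng b).val b = b := by
  have h4 := inv_mul_mul (a := Gpd.inv b) (b := b) (src_inv b)
  rw [Gpd.inv_inv] at h4
  have := mul_mul_assoc (a := b) (b := Gpd.inv b) (c := b) (rng_inv b).symm (src_inv b)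
  exact this.trans h4

lemma range_val_eq : range (UnitSpace.val : UnitSpace G → G) = range (fun g : G => (rng g).val) := by
  ext g
  constructor
  · rintro ⟨x, rfl⟩
    exact ⟨x.val, by simp [rng_val]⟩
  · rintro ⟨x, rfl⟩
    exact ⟨_, rfl⟩

lemma mem_setMul {A B : Set G} {g : G} :
    g ∈ setMul A B ↔ ∃ a ∈ A, ∃ b ∈ B, src a = rng b ∧ g = Gpd.mul a b := by
  simp only [setMul, mem_ofPred_eq, comp_iff]

lemma mul_mem_setMul {A B : Set G} {a b : G} (ha : a ∈ A) (hb : b ∈ B) (h : src a = rng b) :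
    Gpd.mul a b ∈ setMul A B := mem_setMul.2 ⟨a, ha, b, hb, h, rfl⟩

lemma setMul_mono {A A' B B' : Set G} (hA : A ⊆ A') (hB : B ⊆ B') : setMul A B ⊆ setMul A' B' := by
  rintro _ ⟨a, ha, b, hb, h, rfl⟩
  exact ⟨a, hA ha, b, hB hb, h, rfl⟩

lemma setMul_setMul_subset (A B C : Set G) : setMul A (setMul B C) ⊆ setMul (setMul A B) C := by
  intro g hg
  obtain ⟨a, ha, _, hbc, h, rfl⟩ := mem_setMul.1 hg
  obtain ⟨b, hb, c, hc, h', rfl⟩ := mem_setMul.1 hbc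
  rw [rng_mul h'] at h
  rw [← mul_mul_assoc h h']
  exact mul_mem_setMul (mul_mem_setMul ha hb h) hc ((src_mul h).trans h')

lemma subset_setMul {K A : Set G} (hK : range UnitSpace.val ⊆ K) : A ⊆ setMul K A := by
  intro a ha
  refine mem_setMul.2 ⟨(rng a).val, hK ⟨_, rfl⟩, a, ha, src_val _, (val_mul a).symm⟩

lemma outerBoundary_mono {K K' : Set G} (h : K ⊆ K') (A : Set G) :
    outerBoundary K A ⊆ outerBoundary K' A :=
  sdiff_subset_sdiff_left (setMul_mono h subset_rfl)

lemma boundary_mono {K K' : Set G} (h : K ⊆ K') (A : Set G) : boundary K A ⊆ boundary K' A := by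
  apply union_subset_union (outerBoundary_mono h A)
  rintro x ⟨hx, y, hy, h'⟩
  exact ⟨hx, y, h hy, h'⟩

lemma IsFolner.mono {K K' : Set G} {ε ε' : ℝ} {A : Finset G} (h : IsFolner K' ε' A)
    (hK : K ⊆ K') (hε : ε' ≤ ε) : IsFolner K ε A := by
  obtain ⟨h1, h2, h3⟩ := h
  refine ⟨h1, h2.subset (boundary_mono hK _), le_trans ?_ (h3.trans hε)⟩
  gcongr
  exact boundary_mono hK _

end Algebra

/-! ### Étale topology: local homeomorphisms, bisections, minimality. -/

section Topology

variable {G : Type u} [Gpd G] [TopologicalSpace G]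

lemma isEmbedding_val : IsEmbedding (UnitSpace.val : UnitSpace G → G) :=
  ⟨⟨rfl⟩, val_injective⟩

lemma isOpenEmbedding_val (he : IsEtale G) : IsOpenEmbedding (UnitSpace.val : UnitSpace G → G) :=
  ⟨isEmbedding_val, by rw [range_val_eq]; exact he.isOpenMap.isOpen_range⟩

instance [T2Space G] : T2Space (UnitSpace G) := isEmbedding_val.t2Space

lemma continuous_rng (he : IsEtale G) : Continuous (rng : G → UnitSpace G) :=
  isEmbedding_val.continuous_iff.2 he.continuous

lemma continuous_src (ht : IsTopologicalGpd G) (he : IsEtale G) :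
    Continuous (src : G → UnitSpace G) := by
  have : (src : G → UnitSpace G) = rng ∘ Gpd.inv := funext fun g => (rng_inv g).symm
  rw [this]
  exact (continuous_rng he).comp ht.continuous_inv

lemma isLocalHomeomorph_rng (he : IsEtale G) : IsLocalHomeomorph (rng : G → UnitSpace G) := by
  have h1 := (isOpenEmbedding_val he).isLocalHomeomorph
  exact IsLocalHomeomorph.of_comp (g := UnitSpace.val) he h1 (continuous_rng he)

/-- Inversion as a homeomorphism. -/
def invHomeo (ht : IsTopologicalGpd G) : G ≃ₜ G where
  toFun := Gpd.inv
  invFun := Gpd.inv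
  left_inv := Gpd.inv_inv
  right_inv := Gpd.inv_inv
  continuous_toFun := ht.continuous_inv
  continuous_invFun := ht.continuous_inv

lemma isLocalHomeomorph_src (ht : IsTopologicalGpd G) (he : IsEtale G) :
    IsLocalHomeomorph (src : G → UnitSpace G) := by
  have : (src : G → UnitSpace G) = rng ∘ invHomeo ht := funext fun g => (rng_inv g).symm
  rw [this]
  exact (isLocalHomeomorph_rng he).comp (invHomeo ht).isLocalHomeomorph

lemma IsBisection.mono {A B : Set G} (hB : IsBisection B) (h : A ⊆ B) : IsBisection A := by
  obtain ⟨U, hU, hBU, h'⟩ := hB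
  exact ⟨U, hU, h.trans hBU, h'⟩

lemma IsBisection.injOn_src {B : Set G} (hB : IsBisection B) :
    InjOn (src : G → UnitSpace G) B := by
  obtain ⟨U, hU, hBU, h, -⟩ := hB
  exact (injOn_iff_injective.2 h.injective).mono hBU

lemma IsBisection.injOn_rng {B : Set G} (hB : IsBisection B) :
    InjOn (rng : G → UnitSpace G) B := by
  obtain ⟨U, hU, hBU, -, h⟩ := hB
  exact (injOn_iff_injective.2 h.injective).mono hBU

/-- Source and range are continuous open maps, so on an open set injectivity is all that is missing.
-/
lemma isBisection_of_injOn (ht : IsTopologicalGpd G) (he : IsEtale G) {U : Set G} (hU : IsOpen U)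
    (hs : InjOn (src : G → UnitSpace G) U) (hr : InjOn (rng : G → UnitSpace G) U) :
    IsBisection U := by
  refine ⟨U, hU, subset_rfl, ?_, ?_⟩
  · exact IsOpenEmbedding.of_continuous_injective_isOpenMap
      ((continuous_src ht he).comp continuous_subtype_val) (injOn_iff_injective.1 hs)
      ((isLocalHomeomorph_src ht he).isOpenMap.comp hU.isOpenMap_subtype_val)
  · exact IsOpenEmbedding.of_continuous_injective_isOpenMap
      ((continuous_rng he).comp continuous_subtype_val) (injOn_iff_injective.1 hr)
      ((isLocalHomeomorph_rng he).isOpenMap.comp hU.isOpenMap_subtype_val)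

lemma exists_bisection (ht : IsTopologicalGpd G) (he : IsEtale G) (g : G) :
    ∃ B : Set G, IsOpen B ∧ g ∈ B ∧ IsBisection B := by
  obtain ⟨U, hU, hgU, hiU⟩ := (isLocalHomeomorph_rng he).isLocallyInjective g
  obtain ⟨W, hW, hgW, hiW⟩ := (isLocalHomeomorph_src ht he).isLocallyInjective g
  exact ⟨U ∩ W, hU.inter hW, ⟨hgU, hgW⟩, isBisection_of_injOn ht he (hU.inter hW)
    (hiW.mono inter_subset_right) (hiU.mono inter_subset_left)⟩

lemma isBisection_inv (ht : IsTopologicalGpd G) (he : IsEtale G) {B : Set G} (hB : IsBisection B) :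
    IsBisection (Gpd.inv '' B) := by
  obtain ⟨U, hU, hBU, h⟩ := id hB
  have hUb : IsBisection U := ⟨U, hU, subset_rfl, h⟩
  refine (isBisection_of_injOn ht he (U := Gpd.inv '' U) ((invHomeo ht).isOpenMap _ hU) ?_ ?_).mono
    (image_mono hBU)
  · rintro _ ⟨a, ha, rfl⟩ _ ⟨b, hb, rfl⟩ hab
    rw [src_inv, src_inv] at hab
    rw [hUb.injOn_rng ha hb hab]
  · rintro _ ⟨a, ha, rfl⟩ _ ⟨b, hb, rfl⟩ hab
    rw [rng_inv, rng_inv] at hab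
    rw [hUb.injOn_src ha hb hab]

lemma isCompact_setMul [T2Space G] (ht : IsTopologicalGpd G) (he : IsEtale G) {A B : Set G}
    (hA : IsCompact A) (hB : IsCompact B) : IsCompact (setMul A B) := by
  have hc : IsClosed (Gpd.comp : Set (G × G)) := by
    have : (Gpd.comp : Set (G × G)) = {p | src p.1 = rng p.2} := by
      ext ⟨a, b⟩
      exact comp_iff
    rw [this]
    exact isClosed_eq ((continuous_src ht he).comp continuous_fst)
      ((continuous_rng he).comp continuous_snd)
  have : setMul A B = (fun p : G × G => Gpd.mul p.1 p.2) '' ((A ×ˢ B) ∩ Gpd.comp) := by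
    ext g
    constructor
    · rintro ⟨a, ha, b, hb, h, rfl⟩
      exact ⟨(a, b), ⟨⟨ha, hb⟩, h⟩, rfl⟩
    · rintro ⟨⟨a, b⟩, ⟨⟨ha, hb⟩, h⟩, rfl⟩
      exact ⟨a, ha, b, hb, h, rfl⟩
  rw [this]
  exact ((hA.prod hB).inter_right hc).image_of_continuousOn
    (ht.continuousOn_mul.mono inter_subset_right)

lemma compactSub_of_fintype {ι : Type*} [Fintype ι] {K V : Set (UnitSpace G)} (A : ι → Set G)
    (hA : ∀ i, IsOpen (A i) ∧ IsBisection (A i)) (hK : K ⊆ ⋃ i, src '' A i)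
    (hd : Pairwise (fun i j => Disjoint (rng '' A i) (rng '' A j)))
    (hV : ∀ i, rng '' A i ⊆ V) : CompactSub K V := by
  let e := (Fintype.equivFin ι).symm
  refine ⟨Fintype.card ι, fun i => A (e i), fun i => hA _, ?_, ?_, iUnion_subset fun i => hV _⟩
  · rwa [e.surjective.iUnion_comp (fun i => src '' A i)]
  · exact fun i j hij => hd (e.injective.ne hij)

/-- A minimal groupoid moves every unit into every nonempty open set. -/
lemma exists_src_eq_rng_mem (ht : IsTopologicalGpd G) (he : IsEtale G) (hmin : IsMinimal G)
    {W : Set (UnitSpace G)} (hW : IsOpen W) (hne : W.Nonempty) (x : UnitSpace G) :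
    ∃ g : G, src g = x ∧ rng g ∈ W := by
  -- `D` is the saturation of `W`: it is open, and its complement is closed and invariant, so
  -- minimality applies.
  set D : Set (UnitSpace G) := src '' (rng ⁻¹' W) with hD
  have hDo : IsOpen D :=
    (isLocalHomeomorph_src ht he).isOpenMap _ (hW.preimage (continuous_rng he))
  have hinv : IsInvariant Dᶜ := by
    ext y
    constructor
    · rintro ⟨g, hg, rfl⟩ ⟨h, hh, hs⟩
      exact hg ⟨Gpd.mul h g, by rw [mem_preimage, rng_mul hs]; exact hh, src_mul hs⟩
    · intro hy
      exact ⟨y.val, by rw [mem_preimage, src_val]; exact hy, rng_val y⟩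
  rcases hmin _ hDo.isClosed_compl hinv with h | h
  · have hx : x ∈ D := by
      rw [compl_empty_iff] at h
      rw [h]; trivial
    obtain ⟨g, hg, rfl⟩ := hx
    exact ⟨g, rfl, hg⟩
  · obtain ⟨w, hw⟩ := hne
    have : w ∈ D := ⟨w.val, by rw [mem_preimage, rng_val]; exact hw, src_val w⟩
    have hw' : w ∈ Dᶜ := by rw [h]; trivial
    exact absurd this hw'

end Topology

/-! ### Counting: growth of non-Følner sets and invariance of Følner sets. -/

section Growth

variable {G : Type u} [Gpd G]

/-- `K` is covered by `c` sets on which source and range are injective. -/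
def BisectionBound (c : ℕ) (K : Set G) : Prop :=
  ∃ B : Fin c → Set G, (∀ i, InjOn (src : G → UnitSpace G) (B i)) ∧
    (∀ i, InjOn (rng : G → UnitSpace G) (B i)) ∧ K ⊆ ⋃ i, B i

lemma exists_bisectionBound [TopologicalSpace G] (ht : IsTopologicalGpd G) (he : IsEtale G)
    {K : Set G} (hK : IsCompact K) : ∃ c, BisectionBound c K := by
  choose B hB hgB hbB using exists_bisection ht he
  obtain ⟨t, ht⟩ := hK.elim_finite_subcover B hB fun g _ => mem_iUnion.2 ⟨g, hgB g⟩
  refine ⟨t.card, fun i => B (t.equivFin.symm i), fun i => (hbB _).injOn_src,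
    fun i => (hbB _).injOn_rng, fun g hg => ?_⟩
  obtain ⟨x, hx, hgx⟩ := mem_iUnion₂.1 (ht hg)
  exact mem_iUnion.2 ⟨t.equivFin ⟨x, hx⟩, by simpa using hgx⟩

/-- Moving each `p` by a chosen arrow `y p` is at most `c`-to-one: the product has the range of `y
p`, which together with the piece containing `y p` determines `y p`, and then `p` by cancellation.
-/
lemma BisectionBound.card_le {c : ℕ} {K : Set G} (hK : BisectionBound c K) (P Q : Finset G)
    (h : ∀ p ∈ P, ∃ y ∈ K, src y = rng p ∧ Gpd.mul y p ∈ Q) : P.card ≤ c * Q.card := by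
  obtain ⟨B, -, hr, hB⟩ := hK
  choose! y hy hys hyQ using h
  have hi : ∀ p ∈ P, ∃ i, y p ∈ B i := fun p hp => mem_iUnion.1 (hB (hy p hp))
  rcases P.eq_empty_or_nonempty with rfl | ⟨p₀, hp₀⟩
  · simp
  have : Nonempty (Fin c) := ⟨(hi p₀ hp₀).choose⟩
  choose! i hi using hi
  have h1 : P.card ≤ ((Finset.univ : Finset (Fin c)) ×ˢ Q).card := by
    refine Finset.card_le_card_of_injOn (fun p => (i p, Gpd.mul (y p) p)) ?_ ?_
    · intro p hp
      simpa using hyQ p hp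
    · intro p hp q hq hpq
      obtain ⟨h1, h2⟩ := Prod.mk.inj hpq
      have h3 := congrArg rng h2
      rw [rng_mul (hys p hp), rng_mul (hys q hq)] at h3
      have h4 : y p = y q := hr (i p) (hi p hp) (h1 ▸ hi q hq) h3
      rw [← h4] at h2
      exact mul_left_cancel (hys p hp) (h4 ▸ hys q hq) h2
  simpa using h1

lemma BisectionBound.finite_setMul {c : ℕ} {K : Set G} (hK : BisectionBound c K) {A : Set G}
    (hA : A.Finite) : (setMul K A).Finite := by
  obtain ⟨B, hs, -, hB⟩ := hK
  have h1 : (⋃ i, ⋃ a ∈ A, (fun y => Gpd.mul y a) '' {y | y ∈ B i ∧ src y = rng a}).Finite := by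
    refine finite_iUnion fun i => hA.biUnion fun a _ => (Set.Subsingleton.finite ?_).image _
    rintro y ⟨hy, hya⟩ z ⟨hz, hza⟩
    exact hs i hy hz (hya.trans hza.symm)
  refine h1.subset fun g hg => ?_
  obtain ⟨y, hy, a, ha, h, rfl⟩ := mem_setMul.1 hg
  obtain ⟨i, hi⟩ := mem_iUnion.1 (hB hy)
  exact mem_iUnion.2 ⟨i, mem_iUnion₂.2 ⟨a, ha, y, ⟨hi, h⟩, rfl⟩⟩

/-- Each inner boundary point is moved by `K` to an outer one, at most `c`-to-one. The whole
boundary is thus at most `c + 1` times the outer boundary, which is exactly what `K T` adds to `T`.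
-/
lemma BisectionBound.card_ge_of_not_isFolner {c : ℕ} {K : Set G} (hK : BisectionBound c K)
    (hu : range UnitSpace.val ⊆ K) {ε : ℝ} {T : Finset G} (hT : T.Nonempty)
    (hF : ¬ IsFolner K ε T) :
    ∃ T' : Finset G, (T' : Set G) = setMul K T ∧ T ⊆ T' ∧
      (1 + ε / (c + 1)) * T.card ≤ T'.card := by
  classical
  have hfin := hK.finite_setMul T.finite_toSet
  have hO : (outerBoundary K (T : Set G)).Finite := hfin.subset sdiff_subset
  have hI : (innerBoundary K (T : Set G)).Finite := T.finite_toSet.subset fun x hx => hx.1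
  have hB : (boundary K (T : Set G)).Finite := hO.union hI
  have hTp : (0 : ℝ) < T.card := by exact_mod_cast hT.card_pos
  have h1 : ε * T.card < (boundary K (T : Set G)).ncard := by
    by_contra h
    exact hF ⟨hT, hB, (div_le_iff₀ hTp).2 (not_lt.1 h)⟩
  have h2 : (boundary K (T : Set G)).ncard ≤ hO.toFinset.card + hI.toFinset.card := by
    rw [← ncard_eq_toFinset_card _ hO, ← ncard_eq_toFinset_card _ hI]
    exact ncard_union_le _ _
  have h3 : hI.toFinset.card ≤ c * hO.toFinset.card := by
    refine hK.card_le _ _ fun p hp => ?_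
    obtain ⟨hpT, y, hy, hyp, hn⟩ := hI.mem_toFinset.1 hp
    exact ⟨y, hy, comp_iff.1 hyp, hO.mem_toFinset.2 ⟨⟨y, hy, p, hpT, hyp, rfl⟩, hn⟩⟩
  have hsub : T ⊆ hfin.toFinset := fun x hx => hfin.mem_toFinset.2 (subset_setMul hu hx)
  refine ⟨hfin.toFinset, hfin.coe_toFinset, hsub, ?_⟩
  have h4 : hfin.toFinset.card = T.card + hO.toFinset.card := by
    have : hO.toFinset = hfin.toFinset \ T := by
      ext x
      simp [outerBoundary]
    rw [this, Finset.card_sdiff_of_subset hsub]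
    have := Finset.card_le_card hsub
    omega
  have h5 : ε * T.card ≤ (c + 1) * hO.toFinset.card := by
    have h2' : ((boundary K (T : Set G)).ncard : ℝ) ≤ hO.toFinset.card + hI.toFinset.card := by
      exact_mod_cast h2
    have h3' : (hI.toFinset.card : ℝ) ≤ c * hO.toFinset.card := by exact_mod_cast h3
    linarith
  rw [h4]
  push_cast
  have hc : (0 : ℝ) < c + 1 := by positivity
  have h6 : ε / (c + 1) * T.card ≤ hO.toFinset.card := by
    rw [div_mul_eq_mul_div, div_le_iff₀ hc]
    linarith
  linarith

/-- The `n`-fold product `K ⋯ K`, starting from the units. -/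
def powSet (K : Set G) : ℕ → Set G
  | 0 => range UnitSpace.val
  | n + 1 => setMul K (powSet K n)

lemma range_subset_powSet {K : Set G} (hu : range UnitSpace.val ⊆ K) (n : ℕ) :
    range UnitSpace.val ⊆ powSet K n := by
  induction n with
  | zero => exact subset_rfl
  | succ n ih => exact ih.trans (subset_setMul hu)

lemma isCompact_powSet [TopologicalSpace G] [T2Space G] (ht : IsTopologicalGpd G)
    (he : IsEtale G) [CompactSpace (UnitSpace G)] {K : Set G} (hK : IsCompact K) (n : ℕ) :
    IsCompact (powSet K n) := by
  induction n with
  | zero => exact isCompact_range isEmbedding_val.continuous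
  | succ n ih => exact isCompact_setMul ht he hK ih

lemma BisectionBound.exists_isFolner_or_card_ge {c : ℕ} {K : Set G} (hK : BisectionBound c K)
    (hu : range UnitSpace.val ⊆ K) {ε : ℝ} (hε : 0 ≤ ε) {A : Finset G} (hA : A.Nonempty) (n : ℕ) :
    ∃ T : Finset G, A ⊆ T ∧ (T : Set G) ⊆ setMul (powSet K n) A ∧
      (IsFolner K ε T ∨ (1 + ε / (c + 1)) ^ n * A.card ≤ T.card) := by
  induction n with
  | zero => exact ⟨A, subset_rfl, subset_setMul subset_rfl, Or.inr (by simp)⟩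
  | succ n ih =>
    obtain ⟨T, hAT, hT, h⟩ := ih
    have hsub : setMul K (setMul (powSet K n) (A : Set G)) ⊆ setMul (powSet K (n + 1)) A :=
      setMul_setMul_subset _ _ _
    by_cases hF : IsFolner K ε T
    · exact ⟨T, hAT, hT.trans ((subset_setMul hu).trans hsub), Or.inl hF⟩
    · obtain ⟨T', hT', hTT', hc⟩ := hK.card_ge_of_not_isFolner hu (hA.mono hAT) hF
      refine ⟨T', hAT.trans hTT', ?_, Or.inr ?_⟩
      · rw [hT']
        exact (setMul_mono subset_rfl hT).trans hsub
      · have h := h.resolve_left hF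
        refine le_trans ?_ hc
        rw [pow_succ', mul_assoc]
        have : 0 ≤ 1 + ε / (c + 1) := by positivity
        gcongr

open Classical in
/-- The elements of `A` that some element of `K` moves out of `A`. -/
noncomputable def escaping (K : Set G) (A : Finset G) : Finset G :=
  A.filter fun x => ∃ y ∈ K, src y = rng x ∧ Gpd.mul y x ∉ A

lemma IsFolner.card_escaping_le {K : Set G} {ε : ℝ} {A : Finset G} (h : IsFolner K ε A) :
    ((escaping K A).card : ℝ) ≤ ε * A.card := by
  classical
  obtain ⟨hA, hB, h⟩ := h
  have hp : (0 : ℝ) < A.card := by exact_mod_cast hA.card_pos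
  rw [div_le_iff₀ hp] at h
  refine le_trans ?_ h
  rw [Nat.cast_le, ← ncard_coe_finset]
  refine ncard_le_ncard ?_ hB
  intro x hx
  obtain ⟨hx, y, hy, h, h'⟩ := Finset.mem_filter.1 (Finset.mem_coe.1 hx)
  exact Or.inr ⟨hx, y, hy, comp_iff.2 h, h'⟩

lemma mul_mem_of_not_mem_escaping {K : Set G} {A : Finset G} {x y : G} (hx : x ∈ A)
    (hx' : x ∉ escaping K A) (hy : y ∈ K) (h : src y = rng x) : Gpd.mul y x ∈ A := by
  classical
  by_contra hn
  exact hx' (Finset.mem_filter.2 ⟨hx, y, hy, h, hn⟩)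

open Classical in
/-- The number of elements of `A` with range in `Y`. -/
noncomputable def hits (A : Finset G) (Y : Set (UnitSpace G)) : ℕ :=
  (A.filter fun x => rng x ∈ Y).card

lemma hits_mono (A : Finset G) {Y Z : Set (UnitSpace G)} (h : Y ⊆ Z) : hits A Y ≤ hits A Z := by
  classical
  exact Finset.card_le_card (Finset.monotone_filter_right _ fun _ _ hx => h hx)

lemma hits_mono_left {A B : Finset G} (h : A ⊆ B) (Y : Set (UnitSpace G)) :
    hits A Y ≤ hits B Y := by
  classical
  exact Finset.card_le_card (Finset.filter_subset_filter _ h)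

lemma hits_le_add (A : Finset G) {Y Z W : Set (UnitSpace G)} (h : Y ⊆ Z ∪ W) :
    hits A Y ≤ hits A Z + hits A W := by
  classical
  refine le_trans (Finset.card_le_card ?_) (Finset.card_union_le _ _)
  intro x hx
  simp only [Finset.mem_filter, Finset.mem_union] at hx ⊢
  exact (h hx.2).imp (⟨hx.1, ·⟩) (⟨hx.1, ·⟩)

/-- A set with `m` disjoint copies is rarely hit: the `m` translates of the non-escaping part of `A`
over `Y` are disjoint and stay in `A`, and at most `ε |A|` elements escape. -/
lemma IsFolner.mul_hits_le {K : Set G} {ε : ℝ} {A : Finset G} (hF : IsFolner K ε A) {m : ℕ}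
    {Q : Fin m → Set G} {Y : Set (UnitSpace G)} (hQK : ∀ i, Q i ⊆ K)
    (hr : ∀ i, InjOn (rng : G → UnitSpace G) (Q i)) (hY : ∀ i, Y ⊆ src '' Q i)
    (hd : Pairwise fun i j => Disjoint (rng '' Q i) (rng '' Q j)) :
    (m : ℝ) * hits A Y ≤ (1 + m * ε) * A.card := by
  classical
  set S := A.filter fun x => rng x ∈ Y with hS
  have h1 : ∀ i : Fin m, ∀ x ∈ S, ∃ q ∈ Q i, src q = rng x := fun i x hx =>
    hY i (Finset.mem_filter.1 hx).2
  choose! q hq hqs using h1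
  have h2 : ((Finset.univ : Finset (Fin m)) ×ˢ (S \ escaping K A)).card ≤ A.card := by
    refine Finset.card_le_card_of_injOn (fun p => Gpd.mul (q p.1 p.2) p.2) ?_ ?_
    · rintro ⟨i, x⟩ hx
      simp only [Finset.coe_product, mem_prod, Finset.mem_coe, Finset.mem_sdiff] at hx
      exact mul_mem_of_not_mem_escaping (Finset.mem_filter.1 hx.2.1).1 hx.2.2
        (hQK i (hq i x hx.2.1)) (hqs i x hx.2.1)
    · rintro ⟨i, x⟩ hx ⟨j, y⟩ hy hxy
      simp only [Finset.coe_product, mem_prod, Finset.mem_coe, Finset.mem_sdiff] at hx hy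
      replace hx := hx.2.1
      replace hy := hy.2.1
      change Gpd.mul (q i x) x = Gpd.mul (q j y) y at hxy
      have h3 := congrArg rng hxy
      rw [rng_mul (hqs i x hx), rng_mul (hqs j y hy)] at h3
      have hij : i = j := by
        by_contra hne
        exact disjoint_left.1 (hd hne) ⟨_, hq i x hx, rfl⟩ ⟨_, hq j y hy, h3.symm⟩
      subst hij
      have h4 : q i x = q i y := hr i (hq i x hx) (hq i y hy) h3
      rw [← h4] at hxy
      rw [mul_left_cancel (hqs i x hx) (h4 ▸ hqs i y hy) hxy]
  have h3 : S.card ≤ (S \ escaping K A).card + (escaping K A).card := by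
    have := Finset.le_card_sdiff (escaping K A) S
    omega
  have h4 := hF.card_escaping_le
  simp only [Finset.card_product, Finset.card_univ, Fintype.card_fin] at h2
  have h2' : (m : ℝ) * (S \ escaping K A).card ≤ A.card := by exact_mod_cast h2
  have h3' : (S.card : ℝ) ≤ (S \ escaping K A).card + (escaping K A).card := by exact_mod_cast h3
  change (m : ℝ) * S.card ≤ _
  calc (m : ℝ) * S.card ≤ m * ((S \ escaping K A).card + ε * A.card) := by
        gcongr
        linarith
    _ ≤ _ := by linarith

/-- Approximate invariance of the counts, by translating non-escaping elements along `Q`. Allowing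
`Q' ⊆ Q` makes it possible to take `Q` compact and `Q'` its interior, the open-closed form needed to
pass to weak limits. -/
lemma IsFolner.hits_src_le {K : Set G} {ε : ℝ} {A : Finset G} (hF : IsFolner K ε A)
    {Q Q' : Set G} (hQK : Q ⊆ K) (hr : InjOn (rng : G → UnitSpace G) Q) (hQ' : Q' ⊆ Q) :
    (hits A (src '' Q') : ℝ) ≤ hits A (rng '' Q) + ε * A.card := by
  classical
  set S := A.filter fun x => rng x ∈ src '' Q' with hS
  have h1 : ∀ x ∈ S, ∃ q ∈ Q, src q = rng x := fun x hx => by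
    obtain ⟨q, hq, h⟩ := (Finset.mem_filter.1 hx).2
    exact ⟨q, hQ' hq, h⟩
  choose! q hq hqs using h1
  have h2 : (S \ escaping K A).card ≤ hits A (rng '' Q) := by
    refine Finset.card_le_card_of_injOn (fun x => Gpd.mul (q x) x) ?_ ?_
    · intro x hx
      obtain ⟨hx, hx'⟩ := Finset.mem_sdiff.1 hx
      refine Finset.mem_filter.2 ⟨mul_mem_of_not_mem_escaping (Finset.mem_filter.1 hx).1 hx'
        (hQK (hq x hx)) (hqs x hx), ?_⟩
      rw [rng_mul (hqs x hx)]
      exact ⟨_, hq x hx, rfl⟩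
    · intro x hx y hy hxy
      have hx := (Finset.mem_sdiff.1 hx).1
      have hy := (Finset.mem_sdiff.1 hy).1
      change Gpd.mul (q x) x = Gpd.mul (q y) y at hxy
      have h3 := congrArg rng hxy
      rw [rng_mul (hqs x hx), rng_mul (hqs y hy)] at h3
      have h4 : q x = q y := hr (hq x hx) (hq y hy) h3
      rw [← h4] at hxy
      exact mul_left_cancel (hqs x hx) (h4 ▸ hqs y hy) hxy
  have h3 : S.card ≤ (S \ escaping K A).card + (escaping K A).card := by
    have := Finset.le_card_sdiff (escaping K A) S
    omega
  have h4 := hF.card_escaping_le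
  have h5 : (S.card : ℝ) ≤ hits A (rng '' Q) + (escaping K A).card := by
    exact_mod_cast h3.trans (Nat.add_le_add_right h2 _)
  change (S.card : ℝ) ≤ _
  linarith

end Growth

/-! ### Castles: comparing and matching levels. -/

section Castle

variable {G : Type u} [Gpd G] [TopologicalSpace G]

/-- One inclusion factors `C i j` as `C i j · C j j`, where `C j j` consists of units; the other
factors `C j j` as `C j i · C i j`. -/
lemma IsMultisection.src_image {F : Finset ℕ} {C : ℕ → ℕ → Set G} (hC : IsMultisection F C)
    {i j : ℕ} (hi : i ∈ F) (hj : j ∈ F) : src '' C i j = UnitSpace.val ⁻¹' C j j := by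
  ext x
  constructor
  · rintro ⟨g, hg, rfl⟩
    rw [← hC.mul_eq i hi j hj j hj] at hg
    obtain ⟨a, ha, b, hb, h, rfl⟩ := mem_setMul.1 hg
    obtain ⟨z, rfl⟩ := hC.level_subset j hj hb
    rw [src_mul h, src_val]
    exact hb
  · intro hx
    rw [mem_preimage, ← hC.mul_eq j hj i hi j hj] at hx
    obtain ⟨a, ha, b, hb, h, hab⟩ := mem_setMul.1 hx
    exact ⟨b, hb, by rw [← src_mul h, ← hab, src_val]⟩

lemma IsMultisection.rng_image {F : Finset ℕ} {C : ℕ → ℕ → Set G} (hC : IsMultisection F C)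
    {i j : ℕ} (hi : i ∈ F) (hj : j ∈ F) : rng '' C i j = UnitSpace.val ⁻¹' C i i := by
  ext x
  constructor
  · rintro ⟨g, hg, rfl⟩
    rw [← hC.mul_eq i hi i hi j hj] at hg
    obtain ⟨a, ha, b, hb, h, rfl⟩ := mem_setMul.1 hg
    obtain ⟨z, rfl⟩ := hC.level_subset i hi ha
    rw [rng_mul h, rng_val]
    exact ha
  · intro hx
    rw [mem_preimage, ← hC.mul_eq i hi j hj i hi] at hx
    obtain ⟨a, ha, b, hb, h, hab⟩ := mem_setMul.1 hx
    exact ⟨a, ha, by rw [← rng_mul h, ← hab, rng_val]⟩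

section

variable {n : ℕ} {E : Fin n → Finset ℕ} {D : Fin n → ℕ → ℕ → Set G}

/-- The set of units in the level `i` of the tower `l`. -/
def level (D : Fin n → ℕ → ℕ → Set G) (l : Fin n) (i : ℕ) : Set (UnitSpace G) :=
  UnitSpace.val ⁻¹' D l i i

lemma IsOpenCastle.disjoint_level (hD : IsOpenCastle E D) {l l' : Fin n} {i i' : ℕ}
    (hi : i ∈ E l) (hi' : i' ∈ E l') (h : l ≠ l' ∨ i ≠ i') :
    Disjoint (level D l i) (level D l' i') := by
  rw [disjoint_left]
  intro x hx hx'
  by_cases hl : l = l'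
  · subst hl
    exact disjoint_left.1 ((hD.isMultisection l).level_disjoint i hi i' hi'
      (h.resolve_left fun h => h rfl)) hx hx'
  · have := hD.mul_eq_empty l l' hl i hi i hi i' hi' i' hi'
    have h2 : Gpd.mul x.val x.val ∈ setMul (D l i i) (D l' i' i') :=
      mul_mem_setMul hx hx' (by rw [src_val, rng_val])
    rw [this] at h2
    exact h2

lemma IsOpenCastle.exists_mem_of_src_eq (hD : IsOpenCastle E D) {l : Fin n} {j : ℕ}
    (hj : j ∈ E l) {x : UnitSpace G} (hx : x ∈ level D l j) {g : G} (hg : g ∈ castleUnion E D)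
    (hgx : src g = x) : ∃ i ∈ E l, g ∈ D l i j := by
  obtain ⟨l', i, hi, j', hj', hg⟩ := hg
  have h1 : x ∈ level D l' j' := by
    rw [level, ← (hD.isMultisection l').src_image hi hj']
    exact ⟨g, hg, hgx⟩
  by_cases h : l = l' ∧ j = j'
  · obtain ⟨rfl, rfl⟩ := h
    exact ⟨i, hi, hg⟩
  · exact absurd h1 (disjoint_left.1 (hD.disjoint_level hj hj' (by tauto)) hx)

-- Over a fixed unit `x` in level `j`, an arrow of the castle is determined by the level `i` of its
-- range, since it is the only element of `D l i j` with source `x`.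
open Classical in
lemma IsOpenCastle.hits_le (hD : IsOpenCastle E D) {l : Fin n} {j : ℕ}
    (hj : j ∈ E l) {x : UnitSpace G} (hx : x ∈ level D l j) {T : Finset G}
    (hT : (T : Set G) ⊆ castleUnion E D) (hTx : ∀ t ∈ T, src t = x) (Y : Set (UnitSpace G)) :
    hits T Y ≤ ((E l).filter fun i => (level D l i ∩ Y).Nonempty).card := by
  have h1 : ∀ t ∈ T, ∃ i ∈ E l, t ∈ D l i j := fun t ht =>
    hD.exists_mem_of_src_eq hj hx (hT ht) (hTx t ht)
  choose! f hf hfD using h1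
  refine Finset.card_le_card_of_injOn f ?_ ?_
  · intro t ht
    obtain ⟨ht, htY⟩ := Finset.mem_filter.1 ht
    refine Finset.mem_filter.2 ⟨hf t ht, rng t, ?_, htY⟩
    rw [level, ← (hD.isMultisection l).rng_image (hf t ht) hj]
    exact ⟨t, hfD t ht, rfl⟩
  · intro t ht t' ht' h
    have ht := (Finset.mem_filter.1 ht).1
    have ht' := (Finset.mem_filter.1 ht').1
    refine ((hD.isMultisection l).isBisection _ (hf t ht) _ hj).injOn_src (hfD t ht) ?_
      ((hTx t ht).trans (hTx t' ht').symm)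
    rw [h]
    exact hfD t' ht'

-- The growth dichotomy in one tower. The column `A` over `x` has one arrow per level of `F l`; it
-- is enlarged to some `T ⊆ K₀ᴺ A`. If `T` is Følner, `hFol` compares its hits. Otherwise `|T| ≥ c
-- |A|`, and since every unit is moved into `W` by `K₀`, at most `c`-to-one on arrows, `K₀ T` hits
-- `W` at least `|A|` times. This last multiplication is why the exponent is `N + 1`.
open Classical in
lemma IsOpenCastle.card_meeting_le (hD : IsOpenCastle E D) {F : Fin n → Finset ℕ}
    {C : Fin n → ℕ → ℕ → Set G} {K₀ : Set G} {c N : ℕ} (hc : BisectionBound c K₀)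
    (hu : range UnitSpace.val ⊆ K₀) (hext : ExtendsTo (powSet K₀ (N + 1)) F C E D)
    {K U V L W : Set (UnitSpace G)} (hW : ∀ x, ∃ y ∈ K₀, src y = x ∧ rng y ∈ W) {ε : ℝ}
    (hε : 0 ≤ ε) (hN : (c : ℝ) ≤ (1 + ε / (c + 1)) ^ N)
    (hFol : ∀ A : Finset G, IsFolner K₀ ε A → hits A U ≤ hits A L)
    {l : Fin n} (hU : ∀ i ∈ E l, (level D l i ∩ K).Nonempty → level D l i ⊆ U)
    (hL : ∀ i ∈ E l, (level D l i ∩ L).Nonempty → level D l i ⊆ V)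
    (hWV : ∀ i ∈ E l, (level D l i ∩ W).Nonempty → level D l i ⊆ V) :
    ((F l).filter fun i => (level D l i ∩ K).Nonempty).card ≤
      ((E l).filter fun i => level D l i ⊆ V).card := by
  rcases Finset.eq_empty_or_nonempty ((F l).filter fun i => (level D l i ∩ K).Nonempty)
    with h0 | ⟨j, hj⟩
  · rw [h0]; simp
  obtain ⟨hjF, x, hx, -⟩ := Finset.mem_filter.1 hj
  have hjE := hext.index_subset l hjF
  have hms := hD.isMultisection l
  have h1 : ∀ i ∈ F l, ∃ g ∈ D l i j, src g = x := by
    intro i hi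
    have : x ∈ src '' D l i j := by
      rw [hms.src_image (hext.index_subset l hi) hjE]; exact hx
    exact this
  have : Nonempty G := ⟨x.val⟩
  choose! g hg hgx using h1
  have hrg : ∀ i ∈ F l, rng (g i) ∈ level D l i := by
    intro i hi
    rw [level, ← hms.rng_image (hext.index_subset l hi) hjE]
    exact ⟨_, hg i hi, rfl⟩
  have hginj : InjOn g (F l) := by
    intro i hi i' hi' h
    by_contra hne
    refine disjoint_left.1 (hD.disjoint_level (hext.index_subset l hi) (hext.index_subset l hi')
      (Or.inr hne)) (hrg i hi) ?_
    rw [h]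
    exact hrg i' hi'
  set A := (F l).image g with hA
  have hAne : A.Nonempty := ⟨g j, Finset.mem_image_of_mem g hjF⟩
  have hAC : (A : Set G) ⊆ castleUnion F C := by
    intro a ha
    obtain ⟨i, hi, rfl⟩ := Finset.mem_image.1 ha
    exact ⟨l, i, hi, j, hjF, by rw [hext.eq_of_mem l i hi j hjF]; exact hg i hi⟩
  have hAx : ∀ a ∈ A, src a = x := by
    intro a ha
    obtain ⟨i, hi, rfl⟩ := Finset.mem_image.1 ha
    exact hgx i hi
  have hsrc : ∀ (P : Set G) (t : G), t ∈ setMul P (A : Set G) → src t = x := by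
    intro P t ht
    obtain ⟨p, -, a, ha, h, rfl⟩ := mem_setMul.1 ht
    rw [src_mul h, hAx a ha]
  have hsub1 : setMul (powSet K₀ (N + 1)) (A : Set G) ⊆ castleUnion E D :=
    (setMul_mono subset_rfl hAC).trans hext.mul_subset
  obtain ⟨T, hAT, hTK, hT⟩ := hc.exists_isFolner_or_card_ge hu hε hAne N
  have hTsub : setMul K₀ (T : Set G) ⊆ setMul (powSet K₀ (N + 1)) (A : Set G) :=
    (setMul_mono subset_rfl hTK).trans (setMul_setMul_subset _ _ _)
  have hstep1 : ((F l).filter fun i => (level D l i ∩ K).Nonempty).card ≤ hits A U := by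
    refine Finset.card_le_card_of_injOn g ?_ (hginj.mono (Finset.filter_subset _ _))
    intro i hi
    obtain ⟨hi, hiK⟩ := Finset.mem_filter.1 hi
    exact Finset.mem_filter.2 ⟨Finset.mem_image_of_mem g hi,
      hU i (hext.index_subset l hi) hiK (hrg i hi)⟩
  have hlast : ∀ Y : Set (UnitSpace G),
      (∀ i ∈ E l, (level D l i ∩ Y).Nonempty → level D l i ⊆ V) →
      ((E l).filter fun i => (level D l i ∩ Y).Nonempty).card ≤
        ((E l).filter fun i => level D l i ⊆ V).card := by
    intro Y hY
    refine Finset.card_le_card fun i hi => ?_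
    obtain ⟨hi, hiY⟩ := Finset.mem_filter.1 hi
    exact Finset.mem_filter.2 ⟨hi, hY i hi hiY⟩
  rcases hT with hT | hT
  · calc _ ≤ hits A U := hstep1
      _ ≤ hits T U := hits_mono_left hAT U
      _ ≤ hits T L := hFol T hT
      _ ≤ _ := hD.hits_le hjE hx (((subset_setMul hu).trans hTsub).trans hsub1)
        (fun t ht => hsrc _ t (hTK ht)) L
      _ ≤ _ := hlast L hL
  · have hfin := hc.finite_setMul T.finite_toSet
    have hTT : T.card ≤ c * hits hfin.toFinset W := by
      refine hc.card_le _ _ fun p hp => ?_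
      obtain ⟨y, hy, hyp, hyW⟩ := hW (rng p)
      exact ⟨y, hy, hyp, Finset.mem_filter.2
        ⟨hfin.mem_toFinset.2 (mul_mem_setMul hy hp hyp), by rwa [rng_mul hyp]⟩⟩
    have hcA : c * A.card ≤ T.card := by
      have : (c : ℝ) * A.card ≤ T.card := le_trans (by gcongr) hT
      exact_mod_cast this
    have hcpos : 0 < c := by
      obtain ⟨B, -, -, hB⟩ := hc
      obtain ⟨i, -⟩ := mem_iUnion.1 (hB (hu ⟨x, rfl⟩))
      exact i.pos
    have hAW : A.card ≤ hits hfin.toFinset W := Nat.le_of_mul_le_mul_left (hcA.trans hTT) hcpos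
    calc _ ≤ hits A U := hstep1
      _ ≤ A.card := Finset.card_filter_le _ _
      _ ≤ hits hfin.toFinset W := hAW
      _ ≤ _ := hD.hits_le hjE hx (by rw [hfin.coe_toFinset]; exact hTsub.trans hsub1)
        (fun t ht => hsrc _ t (hTsub (hfin.mem_toFinset.1 ht))) W
      _ ≤ _ := hlast W hWV

-- The cardinality bound lets each inner level meeting `K` be sent injectively, within its tower, to
-- an outer level in `V \ O` by a bisection of `D`. The set `O` stays free to receive the remainder.
open Classical in
lemma IsOpenCastle.compactSub (hD : IsOpenCastle E D) {F : Fin n → Finset ℕ}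
    (hFE : ∀ l, F l ⊆ E l) {K V O : Set (UnitSpace G)}
    (hcard : ∀ l, ((F l).filter fun i => (level D l i ∩ K).Nonempty).card ≤
      ((E l).filter fun i => level D l i ⊆ V \ O).card)
    (hO : O ⊆ V) (hrem : CompactSub {x | ∀ l, ∀ i ∈ F l, x ∉ level D l i} O) :
    CompactSub K V := by
  have h1 : ∀ l, Nonempty (((F l).filter fun i => (level D l i ∩ K).Nonempty : Finset ℕ) ↪
      ((E l).filter fun i => level D l i ⊆ V \ O : Finset ℕ)) := fun l =>
    Function.Embedding.nonempty_of_card_le (by simpa using hcard l)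
  let φ := fun l => (h1 l).some
  obtain ⟨m, B, hB, hBK, hBd, hBO⟩ := hrem
  have hms := hD.isMultisection
  have hs : ∀ l (i : ((F l).filter fun i => (level D l i ∩ K).Nonempty : Finset ℕ)),
      (i : ℕ) ∈ E l := fun l i => hFE l (Finset.mem_filter.1 i.2).1
  have ht : ∀ l (i : ((F l).filter fun i => (level D l i ∩ K).Nonempty : Finset ℕ)),
      (φ l i : ℕ) ∈ E l := fun l i => (Finset.mem_filter.1 (φ l i).2).1
  have ht' : ∀ l (i : ((F l).filter fun i => (level D l i ∩ K).Nonempty : Finset ℕ)),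
      level D l (φ l i) ⊆ V \ O := fun l i => (Finset.mem_filter.1 (φ l i).2).2
  let A : (Σ l, ((F l).filter fun i => (level D l i ∩ K).Nonempty : Finset ℕ)) ⊕ Fin m → Set G :=
    Sum.elim (fun p => D p.1 (φ p.1 p.2) p.2) B
  have hr : ∀ p, rng '' A (Sum.inl p) = level D p.1 (φ p.1 p.2) := fun p =>
    (hms p.1).rng_image (ht _ _) (hs _ _)
  have hBO' : ∀ k, rng '' B k ⊆ O := fun k => (subset_iUnion (fun k => rng '' B k) k).trans hBO
  refine compactSub_of_fintype A ?_ ?_ ?_ ?_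
  · rintro (p | k)
    · exact ⟨hD.isOpen _ _ (ht _ _) _ (hs _ _), (hms _).isBisection _ (ht _ _) _ (hs _ _)⟩
    · exact hB k
  · intro x hx
    by_cases h : ∀ l, ∀ i ∈ F l, x ∉ level D l i
    · obtain ⟨k, hk⟩ := mem_iUnion.1 (hBK h)
      exact mem_iUnion.2 ⟨Sum.inr k, hk⟩
    · push Not at h
      obtain ⟨l, i, hi, hxi⟩ := h
      refine mem_iUnion.2 ⟨Sum.inl ⟨l, i, Finset.mem_filter.2 ⟨hi, x, hxi, hx⟩⟩, ?_⟩
      change x ∈ src '' D l _ _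
      rw [(hms l).src_image (ht _ _) (hs _ _)]
      exact hxi
  · have hpk : ∀ p k, Disjoint (rng '' A (Sum.inl p)) (rng '' B k) := fun p k => by
      rw [hr]
      exact (disjoint_sdiff_left (s := O) (t := V)).mono (ht' _ _) (hBO' k)
    rintro (p | k) (q | k') hne
    · rw [hr, hr]
      refine hD.disjoint_level (ht _ _) (ht _ _) ?_
      obtain ⟨l, i⟩ := p
      obtain ⟨l', i'⟩ := q
      by_cases hl : l = l'
      · subst hl
        refine Or.inr fun h => hne ?_
        have hii : i = i' := (φ l).injective (Subtype.ext h)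
        rw [hii]
      · exact Or.inl hl
    · exact hpk p k'
    · exact (hpk q k).symm
    · exact hBd fun h => hne (congrArg _ h)
  · rintro (p | k)
    · rw [hr]
      exact (ht' _ _).trans sdiff_subset
    · exact (hBO' k).trans hO

end

end Castle

/-! ### From inequalities along Følner sets to subequivalence. -/

section Main

variable {G : Type u} [Gpd G] [TopologicalSpace G]

lemma exists_compact_bisection_nhds [LocallyCompactSpace G] (ht : IsTopologicalGpd G)
    (he : IsEtale G) (g : G) {W : Set (UnitSpace G)} (hW : IsOpen W) (hg : rng g ∈ W) :
    ∃ N : Set G, IsCompact N ∧ InjOn (rng : G → UnitSpace G) N ∧ rng '' N ⊆ W ∧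
      src '' N ∈ 𝓝 (src g) := by
  obtain ⟨B, hB, hgB, hb⟩ := exists_bisection ht he g
  obtain ⟨N, hN, hNs, hNc⟩ := local_compact_nhds
    ((hB.inter (hW.preimage (continuous_rng he))).mem_nhds ⟨hgB, hg⟩)
  exact ⟨N, hNc, hb.injOn_rng.mono fun x hx => (hNs hx).1, image_subset_iff.2 fun x hx => (hNs hx).2,
    (isLocalHomeomorph_src ht he).isOpenMap.image_mem_nhds hN⟩

lemma exists_compact_moving [LocallyCompactSpace G] [CompactSpace (UnitSpace G)]
    (ht : IsTopologicalGpd G) (he : IsEtale G)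
    (hmin : IsMinimal G) {W : Set (UnitSpace G)} (hW : IsOpen W) (hne : W.Nonempty) :
    ∃ Q : Set G, IsCompact Q ∧ ∀ x, ∃ y ∈ Q, src y = x ∧ rng y ∈ W := by
  choose g hgx hgW using exists_src_eq_rng_mem ht he hmin hW hne
  choose N hNc _ hNW hN using fun x => exists_compact_bisection_nhds ht he (g x) hW (hgW x)
  obtain ⟨t, ht⟩ := CompactSpace.elim_nhds_subcover (fun x => src '' N x)
    fun x => by simpa [hgx] using hN x
  refine ⟨⋃ x ∈ t, N x, t.isCompact_biUnion fun x _ => hNc x, fun x => ?_⟩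
  have hx : x ∈ ⋃ x ∈ t, src '' N x := by rw [ht]; trivial
  obtain ⟨z, hz, y, hy, rfl⟩ := mem_iUnion₂.1 hx
  exact ⟨y, mem_iUnion₂.2 ⟨z, hz, hy⟩, rfl, hNW z ⟨y, hy, rfl⟩⟩

/-- Orbits are dense by minimality; a finite one would be closed, hence the whole unit space. -/
lemma infinite_orbit [T2Space G] [Infinite (UnitSpace G)] (ht : IsTopologicalGpd G)
    (he : IsEtale G) (hmin : IsMinimal G) (v : UnitSpace G) :
    (rng '' (src ⁻¹' {v} : Set G)).Infinite := by
  intro hfin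
  have hd : Dense (rng '' (src ⁻¹' {v} : Set G)) := by
    refine dense_iff_inter_open.2 fun W hW hne => ?_
    obtain ⟨g, hg, hgW⟩ := exists_src_eq_rng_mem ht he hmin hW hne v
    exact ⟨rng g, hgW, g, hg, rfl⟩
  have := hd.closure_eq
  rw [hfin.isClosed.closure_eq] at this
  rw [this] at hfin
  exact infinite_univ hfin

/-- By minimality a bisection carries any unit to an isolated one, so all units would be isolated,
and a compact discrete space is finite. -/
lemma not_isOpen_singleton [T2Space G] [CompactSpace (UnitSpace G)] [Infinite (UnitSpace G)]
    (ht : IsTopologicalGpd G) (he : IsEtale G) (hmin : IsMinimal G) (v : UnitSpace G) :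
    ¬ IsOpen {v} := by
  intro hv
  have hdisc : DiscreteTopology (UnitSpace G) := by
    refine discreteTopology_iff_isOpen_singleton.2 fun x => ?_
    obtain ⟨g, hgx, hgv⟩ := exists_src_eq_rng_mem ht he hmin hv (singleton_nonempty v) x
    obtain ⟨B, hB, hgB, hb⟩ := exists_bisection ht he g
    have h1 : IsOpen (src '' (B ∩ rng ⁻¹' {v})) :=
      (isLocalHomeomorph_src ht he).isOpenMap _ (hB.inter (hv.preimage (continuous_rng he)))
    have h2 : src '' (B ∩ rng ⁻¹' {v}) = {x} := by
      ext y
      constructor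
      · rintro ⟨h, ⟨hhB, hhv⟩, rfl⟩
        rw [hb.injOn_rng hhB hgB (hhv.trans hgv.symm), hgx]
        rfl
      · rintro rfl
        exact ⟨g, ⟨hgB, hgv⟩, hgx⟩
    rwa [h2] at h1
  exact (finite_of_compact_of_discrete (X := UnitSpace G)).false

lemma exists_disjoint_copies [LocallyCompactSpace G] [T2Space G] [Infinite (UnitSpace G)]
    (ht : IsTopologicalGpd G) (he : IsEtale G) (hmin : IsMinimal G) (v : UnitSpace G) (m : ℕ) :
    ∃ Q : Fin m → Set G, (∀ i, IsCompact (Q i)) ∧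
      (∀ i, InjOn (rng : G → UnitSpace G) (Q i)) ∧ (∀ i, src '' Q i ∈ 𝓝 v) ∧
      Pairwise fun i j => Disjoint (rng '' Q i) (rng '' Q j) := by
  have hinf := infinite_orbit ht he hmin v
  let f := hinf.natEmbedding
  choose g hgv hgf using fun i : Fin m => (f i).2
  obtain ⟨U, hU, hUd⟩ := (finite_range fun i : Fin m => rng (g i)).t2_separation
  choose Q hQc hQr hQU hQn using fun i : Fin m =>
    exists_compact_bisection_nhds ht he (g i) (hU (rng (g i))).2 (hU (rng (g i))).1
  refine ⟨Q, hQc, hQr, fun i => ?_, fun i j hij => ?_⟩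
  · have := hQn i
    rwa [show src (g i) = v from hgv i] at this
  · refine (hUd (mem_range_self i) (mem_range_self j) fun h => hij ?_).mono (hQU i) (hQU j)
    rw [hgf, hgf] at h
    exact Fin.ext (f.injective (Subtype.ext h))

/-- Comparison holds as soon as it holds, with some room, along all Følner sets. -/
theorem compactSub_of_isFolner_hits [LocallyCompactSpace G] [T2Space G]
    [CompactSpace (UnitSpace G)] [Infinite (UnitSpace G)] (ht : IsTopologicalGpd G)
    (he : IsEtale G) (hmin : IsMinimal G) (hae : AlmostElementary G)
    {K V U L : Set (UnitSpace G)} (hK : IsCompact K) (hV : IsOpen V) (hVne : V.Nonempty)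
    (hU : IsOpen U) (hKU : K ⊆ U) (hL : IsCompact L) (hLV : L ⊆ V) {K₀ : Set G}
    (hK₀ : IsCompact K₀) {ε δ : ℝ} (hε : 0 < ε) (hδ : 0 < δ)
    (h : ∀ A : Finset G, IsFolner K₀ ε A → hits A U + δ * A.card ≤ hits A L) :
    CompactSub K V := by
  classical
  -- Two points of `V` are needed: a neighbourhood `N` of `v` is reserved for the remainder of the
  -- castle, and a disjoint neighbourhood `N'` of `w` is the target when the columns keep growing.
  obtain ⟨v, hv⟩ := hVne
  obtain ⟨w, hw, hwv⟩ : ∃ w ∈ V, w ≠ v := by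
    by_contra! hcon
    refine not_isOpen_singleton ht he hmin v ?_
    rwa [show {v} = V from (Subset.antisymm (singleton_subset_iff.2 hv) hcon)]
  -- With `m` disjoint copies and `ε₁ ≤ δ / 2`, a Følner set hits `O'` at most `(1 / m + ε₁) |A| ≤ δ
  -- |A|` times, so the gap `δ` pays for removing `O'` from `L`.
  obtain ⟨m, hm⟩ := exists_nat_gt (2 / δ)
  have hmpos : (0 : ℝ) < m := lt_trans (by positivity) hm
  obtain ⟨Q, hQc, hQr, hQn, hQd⟩ := exists_disjoint_copies ht he hmin v m
  set O' : Set (UnitSpace G) := interior (⋂ i, src '' Q i) ∩ (V \ {w}) with hO'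
  have hO'o : IsOpen O' := isOpen_interior.inter (hV.sdiff isClosed_singleton)
  have hvO' : v ∈ O' := ⟨mem_interior_iff_mem_nhds.2 (Filter.iInter_mem.2 hQn), hv, hwv.symm⟩
  obtain ⟨N, hNv, hNc, hNO'⟩ := exists_mem_nhds_isClosed_subset (hO'o.mem_nhds hvO')
  have hV1 : IsOpen (V \ N) := hV.sdiff hNc
  obtain ⟨N', hN'w, hN'c, hN'V⟩ := exists_mem_nhds_isClosed_subset
    (hV1.mem_nhds (⟨hw, fun hwN => (hNO' hwN).2.2 rfl⟩ : w ∈ V \ N))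
  obtain ⟨QW, hQWc, hQW⟩ := exists_compact_moving ht he hmin isOpen_interior
    ⟨w, mem_interior_iff_mem_nhds.2 hN'w⟩
  set K₁ : Set G := K₀ ∪ (range UnitSpace.val ∪ ((⋃ i, Q i) ∪ QW)) with hK₁
  have hK₁c : IsCompact K₁ := hK₀.union
    ((isCompact_range isEmbedding_val.continuous).union ((isCompact_iUnion hQc).union hQWc))
  have hu : range UnitSpace.val ⊆ K₁ := subset_union_left.trans subset_union_right
  set ε₁ := min ε (δ / 2)
  have hε₁ : 0 < ε₁ := lt_min hε (by positivity)
  obtain ⟨c, hc⟩ := exists_bisectionBound ht he hK₁c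
  obtain ⟨n, hn⟩ := pow_unbounded_of_one_lt (c : ℝ)
    (show 1 < 1 + ε₁ / (c + 1) from lt_add_of_pos_right _ (by positivity))
  have hL1 : IsClosed ((L \ O') ∪ N') := (hL.isClosed.sdiff hO'o).union hN'c
  have hL1V : (L \ O') ∪ N' ⊆ V \ N :=
    union_subset (fun x hx => ⟨hLV hx.1, fun hxN => hx.2 (hNO' hxN)⟩) hN'V
  have hFol : ∀ A : Finset G, IsFolner K₁ ε₁ A → hits A U ≤ hits A ((L \ O') ∪ N') := by
    intro A hA
    have h1 := h A (hA.mono subset_union_left (min_le_left _ _))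
    have h2 : hits A L ≤ hits A ((L \ O') ∪ N') + hits A O' := by
      refine hits_le_add A fun x hx => ?_
      by_cases hxO : x ∈ O'
      · exact Or.inr hxO
      · exact Or.inl (Or.inl ⟨hx, hxO⟩)
    have h3 := hA.mul_hits_le (Q := Q) (Y := O')
      (fun i => ((subset_iUnion Q i).trans subset_union_left).trans
        (subset_union_right.trans subset_union_right)) hQr
      (fun i => inter_subset_left.trans (interior_subset.trans (iInter_subset _ i))) hQd
    have h4 : (hits A O' : ℝ) ≤ δ * A.card := by
      refine le_of_mul_le_mul_left (h3.trans ?_) hmpos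
      rw [← mul_assoc]
      gcongr
      have h5 : ε₁ ≤ δ / 2 := min_le_right _ _
      have h6 : 2 < m * δ := by rwa [div_lt_iff₀ hδ] at hm
      nlinarith
    have h2' : (hits A L : ℝ) ≤ hits A ((L \ O') ∪ N') + hits A O' := by exact_mod_cast h2
    have : (hits A U : ℝ) ≤ hits A ((L \ O') ∪ N') := by linarith
    exact_mod_cast this
  have hKc := hK.isClosed
  obtain ⟨k, F, E, C, D, hC, hD, hext, hsmall, hrem⟩ := hae (powSet K₁ (n + 1))
    (isCompact_powSet ht he hK₁c _) (range_subset_powSet hu _) (interior N) isOpen_interior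
    ⟨v, mem_interior_iff_mem_nhds.2 hNv⟩
    -- Common refinement of the covers `{U, Kᶜ}` and `{V \ N, ((L \ O') ∪ N')ᶜ}`: a level meeting
    -- the closed set `K` or `(L \ O') ∪ N'` must lie in `U` or `V \ N` respectively.
    {U ∩ (V \ N), U ∩ ((L \ O') ∪ N')ᶜ, Kᶜ ∩ (V \ N), Kᶜ ∩ ((L \ O') ∪ N')ᶜ}
    (by
      rintro S (rfl | rfl | rfl | rfl)
      · exact hU.inter hV1
      · exact hU.inter hL1.isOpen_compl
      · exact hKc.isOpen_compl.inter hV1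
      · exact hKc.isOpen_compl.inter hL1.isOpen_compl)
    (by
      refine eq_univ_of_forall fun x => ?_
      by_cases h1 : x ∈ K <;> by_cases h2 : x ∈ (L \ O') ∪ N'
      · exact ⟨_, Or.inl rfl, hKU h1, hL1V h2⟩
      · exact ⟨_, Or.inr (Or.inl rfl), hKU h1, h2⟩
      · exact ⟨_, Or.inr (Or.inr (Or.inl rfl)), h1, hL1V h2⟩
      · exact ⟨_, Or.inr (Or.inr (Or.inr rfl)), h1, h2⟩)
  have hlev : ∀ l, ∀ i ∈ E l, ((level D l i ∩ K).Nonempty → level D l i ⊆ U) ∧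
      ((level D l i ∩ ((L \ O') ∪ N')).Nonempty → level D l i ⊆ V \ N) := by
    intro l i hi
    obtain ⟨S, hS, hDS⟩ := hsmall l i hi
    have hDS' : level D l i ⊆ S := by
      intro x hx
      obtain ⟨y, hy, hxy⟩ := hDS hx
      exact val_injective hxy ▸ hy
    constructor
    · rintro ⟨x, hx, hxK⟩
      have hxS := hDS' hx
      rcases hS with rfl | rfl | rfl | rfl
      · exact hDS'.trans inter_subset_left
      · exact hDS'.trans inter_subset_left
      · exact absurd hxK hxS.1
      · exact absurd hxK hxS.1
    · rintro ⟨x, hx, hxL⟩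
      have hxS := hDS' hx
      rcases hS with rfl | rfl | rfl | rfl
      · exact hDS'.trans inter_subset_right
      · exact absurd hxL hxS.2
      · exact hDS'.trans inter_subset_right
      · exact absurd hxL hxS.2
  refine hD.compactSub (O := interior N) (V := V) hext.index_subset (fun l => ?_)
    (interior_subset.trans fun x hx => (hNO' hx).2.1) ?_
  · refine (hD.card_meeting_le hc hu hext (V := V \ N) (L := (L \ O') ∪ N') (W := interior N')
      (fun x => ?_) hε₁.le hn.le hFol (fun i hi => (hlev l i hi).1)
      (fun i hi => (hlev l i hi).2) (fun i hi h => (hlev l i hi).2 (h.mono ?_))).trans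
      (Finset.card_le_card fun i hi => ?_)
    · obtain ⟨y, hy, hyx⟩ := hQW x
      exact ⟨y, Or.inr (Or.inr (Or.inr hy)), hyx⟩
    · exact inter_subset_inter_right _ (interior_subset.trans subset_union_right)
    · obtain ⟨hi, h⟩ := Finset.mem_filter.1 hi
      exact Finset.mem_filter.2 ⟨hi, h.trans (sdiff_subset_sdiff_right interior_subset)⟩
  · convert hrem using 1
    ext x
    simp only [castleLevels, mem_compl_iff, mem_ofPred_eq, not_exists, not_and]
    refine forall_congr' fun l => forall_congr' fun i => forall_congr' fun hi => ?_
    rw [hext.eq_of_mem l i hi i hi]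
    rfl

end Main

/-! ### Invariant measures as limits of empirical measures. -/

section Measures

open Filter ENNReal

variable {G : Type u} [Gpd G] [TopologicalSpace G]

/-- The uniform distribution of the ranges of the elements of `A`. -/
noncomputable def empirical (A : Finset G) : Measure (UnitSpace G) :=
  (A.card : ℝ≥0∞)⁻¹ • ∑ a ∈ A, Measure.dirac (rng a)

lemma empirical_apply (A : Finset G) {Y : Set (UnitSpace G)} (hY : MeasurableSet Y) :
    empirical A Y = hits A Y / A.card := by
  classical
  rw [empirical, Measure.smul_apply, Measure.finsetSum_apply, smul_eq_mul, ENNReal.div_eq_inv_mul]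
  congr 1
  simp only [Measure.dirac_apply' _ hY, indicator_apply, Pi.one_apply]
  rw [Finset.sum_boole]
  rfl

lemma isProbabilityMeasure_empirical {A : Finset G} (hA : A.Nonempty) :
    IsProbabilityMeasure (empirical A) := by
  constructor
  have h : (A.card : ℝ≥0∞) ≠ 0 := by exact_mod_cast hA.card_pos.ne'
  rw [empirical_apply A MeasurableSet.univ]
  have : hits A univ = A.card := by simp [hits]
  rw [this, ENNReal.div_self h (natCast_ne_top _)]

/-- The uniform distribution of the ranges of the elements of a nonempty set `A`. -/
noncomputable def empiricalProb (A : Finset G) (hA : A.Nonempty) :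
    ProbabilityMeasure (UnitSpace G) :=
  ⟨empirical A, isProbabilityMeasure_empirical hA⟩

/-- The portmanteau inequalities bound open sets from below and closed sets from above. If `μ C < a
< b < μ O`, the error would have to exceed `b - a` eventually, although it tends to zero. -/
lemma measure_le_of_hits_le [HasOuterApproxClosed (UnitSpace G)] {ι : Type*} {f : Filter ι}
    [f.NeBot] {A : ι → Finset G} (hA : ∀ p, (A p).Nonempty) {μ : ProbabilityMeasure (UnitSpace G)}
    (hμ : Tendsto (fun p => empiricalProb (A p) (hA p)) f (𝓝 μ)) {δ : ι → ℝ}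
    (hδ : Tendsto δ f (𝓝 0)) (hδ0 : ∀ p, 0 ≤ δ p) {O C : Set (UnitSpace G)} (hO : IsOpen O)
    (hC : IsClosed C)
    (h : ∀ᶠ p in f, (hits (A p) O : ℝ) ≤ hits (A p) C + δ p * (A p).card) :
    (μ : Measure (UnitSpace G)) O ≤ (μ : Measure (UnitSpace G)) C := by
  by_contra hlt
  obtain ⟨a, hCa, haO⟩ := exists_between (not_le.1 hlt)
  obtain ⟨b, hab, hbO⟩ := exists_between haO
  have h1 := ProbabilityMeasure.limsup_measure_closed_le_of_tendsto hμ hC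
  have h2 := ProbabilityMeasure.le_liminf_measure_open_of_tendsto hμ hO
  have e1 := eventually_lt_of_limsup_lt (h1.trans_lt hCa)
  have e2 := eventually_lt_of_lt_liminf (hbO.trans_le h2)
  have e3 : ∀ᶠ p in f, ENNReal.ofReal (δ p) < b - a := by
    have : Tendsto (fun p => ENNReal.ofReal (δ p)) f (𝓝 0) := by
      simpa using ENNReal.tendsto_ofReal hδ
    exact this.eventually_lt_const (tsub_pos_of_lt hab)
  obtain ⟨p, hp, hp1, hp2, hp3⟩ := (h.and (e1.and (e2.and e3))).exists
  change empirical (A p) C < a at hp1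
  change b < empirical (A p) O at hp2
  have hcard : (0 : ℝ) < (A p).card := by exact_mod_cast (hA p).card_pos
  have key : empirical (A p) O ≤ empirical (A p) C + ENNReal.ofReal (δ p) := by
    rw [empirical_apply _ hO.measurableSet, empirical_apply _ hC.measurableSet]
    have hconv : ∀ Y : Set (UnitSpace G), (hits (A p) Y : ℝ≥0∞) / ((A p).card : ℝ≥0∞) =
        ENNReal.ofReal (hits (A p) Y / (A p).card) := by
      intro Y
      rw [ENNReal.ofReal_div_of_pos hcard, ENNReal.ofReal_natCast, ENNReal.ofReal_natCast]
    rw [hconv, hconv, ← ENNReal.ofReal_add (by positivity) (hδ0 p)]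
    apply ENNReal.ofReal_le_ofReal
    rw [div_add' _ _ _ hcard.ne']
    gcongr
  have : b < a + (b - a) := (hp2.trans_le key).trans_le (add_le_add hp1.le hp3.le)
  rw [add_tsub_cancel_of_le hab.le] at this
  exact lt_irrefl _ this

/-- If `μ(s(int Q)) ≤ μ(r(Q))` for all compact sets `Q` of arrows on which `r` is injective, then
`μ` is invariant. -/
lemma mem_invariantMeasures_of_le [LocallyCompactSpace G] [T2Space G]
    [CompactSpace (UnitSpace G)] (ht : IsTopologicalGpd G) (he : IsEtale G)
    {μ : Measure (UnitSpace G)} [IsProbabilityMeasure μ] [μ.Regular]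
    (h : ∀ Q : Set G, IsCompact Q → InjOn (rng : G → UnitSpace G) Q →
      μ (src '' interior Q) ≤ μ (rng '' Q)) : μ ∈ invariantMeasures G := by
  -- For compact `C`, outer regularity of `r(C)` leaves room for a compact `Q` with `C` in its
  -- interior and `r(Q)` of nearly the same measure.
  have hcomp : ∀ B : Set G, IsBisection B → ∀ C ⊆ B, IsCompact C →
      μ (src '' C) ≤ μ (rng '' C) := by
    intro B ⟨U, hU, hBU, hs, hr⟩ C hCB hC
    refine le_of_forall_gt fun a ha => ?_
    obtain ⟨W, hCW, hW, hWa⟩ := (rng '' C).exists_isOpen_lt_of_lt a ha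
    obtain ⟨Q, hQ, hCQ, hQU⟩ := exists_compact_between hC
      (hU.inter (hW.preimage (continuous_rng he)))
      (subset_inter (hCB.trans hBU) (image_subset_iff.1 hCW))
    have hUb : IsBisection U := ⟨U, hU, subset_rfl, hs, hr⟩
    calc μ (src '' C) ≤ μ (src '' interior Q) := measure_mono (image_mono hCQ)
      _ ≤ μ (rng '' Q) := h Q hQ (hUb.injOn_rng.mono fun x hx => (hQU hx).1)
      _ ≤ μ W := measure_mono (image_subset_iff.2 fun x hx => (hQU hx).2)
      _ < a := hWa
  -- Inner regularity of `s(B)` reduces the Borel case to compact subsets, lifted back through the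
  -- source map.
  have hborel : ∀ B : Set G, MeasurableSet[borel G] B → IsBisection B →
      μ (src '' B) ≤ μ (rng '' B) := by
    intro B hBm hB
    obtain ⟨U, hU, hBU, hs, hr⟩ := id hB
    let _ : MeasurableSpace G := borel G
    have : BorelSpace G := ⟨rfl⟩
    have hms : MeasurableSet (src '' B) := by
      have h1 := hs.measurableEmbedding.measurableSet_image.2
        (measurable_subtype_coe hBm : MeasurableSet ((↑) ⁻¹' B : Set U))
      have h2 : U.domRestrict (src : G → UnitSpace G) '' ((↑) ⁻¹' B : Set U) = src '' B := by
        rw [show U.domRestrict (src : G → UnitSpace G) = src ∘ ((↑) : U → G) from rfl, image_comp,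
          Subtype.image_preimage_coe, inter_eq_right.2 hBU]
      rwa [h2] at h1
    refine le_of_forall_lt fun a ha => ?_
    obtain ⟨Z, hZB, hZ, haZ⟩ := hms.exists_lt_isCompact_of_ne_top (measure_ne_top _ _) ha
    have hUb : IsBisection U := ⟨U, hU, subset_rfl, hs, hr⟩
    have hZr : Z ⊆ range (U.domRestrict (src : G → UnitSpace G)) := by
      rintro _ hz
      obtain ⟨b, hb, rfl⟩ := hZB hz
      exact ⟨⟨b, hBU hb⟩, rfl⟩
    have hCc : IsCompact ((↑) '' (U.domRestrict (src : G → UnitSpace G) ⁻¹' Z) : Set G) :=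
      ((hs.isInducing.isCompact_preimage_iff hZr).2 hZ).image continuous_subtype_val
    have hCB : ((↑) '' (U.domRestrict (src : G → UnitSpace G) ⁻¹' Z) : Set G) ⊆ B := by
      rintro _ ⟨u, hu, rfl⟩
      obtain ⟨b, hb, hbu⟩ := hZB hu
      rwa [hUb.injOn_src u.2 (hBU hb) hbu.symm]
    have hZC : Z ⊆ src '' ((↑) '' (U.domRestrict (src : G → UnitSpace G) ⁻¹' Z) : Set G) := by
      intro z hz
      obtain ⟨u, rfl⟩ := hZr hz
      exact ⟨u, ⟨u, hz, rfl⟩, rfl⟩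
    calc a < μ Z := haZ
      _ ≤ _ := measure_mono hZC
      _ ≤ _ := hcomp B hB _ hCB hCc
      _ ≤ _ := measure_mono (image_mono hCB)
  -- The reverse inequality is the same one for the inverse bisection.
  refine ⟨inferInstance, inferInstance, fun B hBm hB => le_antisymm ?_ (hborel B hBm hB)⟩
  have h1 : src '' (Gpd.inv '' B : Set G) = rng '' B := by simp [image_image, src_inv]
  have h2 : rng '' (Gpd.inv '' B : Set G) = src '' B := by simp [image_image, rng_inv]
  rw [← h1, ← h2]
  refine hborel _ ?_ (isBisection_inv ht he hB)
  let _ : MeasurableSpace G := borel G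
  have : BorelSpace G := ⟨rfl⟩
  exact (invHomeo ht).measurableEmbedding.measurableSet_image.2 hBm

/-- A strict inequality for all invariant measures holds, with some room, along Følner sets. -/
theorem exists_isFolner_hits_add_le [LocallyCompactSpace G] [T2Space G]
    [CompactSpace (UnitSpace G)] [TopologicalSpace.MetrizableSpace (UnitSpace G)]
    (ht : IsTopologicalGpd G) (he : IsEtale G)
    {K U V : Set (UnitSpace G)} (hU : IsOpen U) (hV : IsOpen V)
    (hUV : ∀ μ ∈ invariantMeasures G, μ U < μ V) (hK : IsCompact K) (hKU : K ⊆ U) :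
    ∃ U' L : Set (UnitSpace G), IsOpen U' ∧ K ⊆ U' ∧ IsCompact L ∧ L ⊆ V ∧
      ∃ K₀ : Set G, IsCompact K₀ ∧ ∃ ε > (0 : ℝ), ∃ δ > (0 : ℝ),
        ∀ A : Finset G, IsFolner K₀ ε A → hits A U' + δ * A.card ≤ hits A L := by
  obtain ⟨U', hU', hKU', hU'U⟩ := normal_exists_closure_subset hK.isClosed hU hKU
  -- Failure for every choice gives counterexamples `A p` indexed by the directed set of triples
  -- (compact `K₀`, compact `L ⊆ V`, natural number); an ultrafilter finer than `atTop` produces a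
  -- limit measure.
  by_contra hcon
  push Not at hcon
  let _ : SemilatticeSup {L : TopologicalSpace.Compacts (UnitSpace G) // (L : Set (UnitSpace G)) ⊆ V} :=
    Subtype.semilatticeSup fun L L' hL hL' => by simpa using ⟨hL, hL'⟩
  have : Nonempty
      {L : TopologicalSpace.Compacts (UnitSpace G) // (L : Set (UnitSpace G)) ⊆ V} :=
    ⟨⊥, by simp⟩
  have hex : ∀ p : TopologicalSpace.Compacts G ×
      {L : TopologicalSpace.Compacts (UnitSpace G) // (L : Set (UnitSpace G)) ⊆ V} × ℕ,
      ∃ A : Finset G, IsFolner p.1 (1 / ((p.2.2 : ℝ) + 1)) A ∧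
        (hits A p.2.1.1 : ℝ) < hits A U' + 1 / ((p.2.2 : ℝ) + 1) * A.card := fun p =>
    hcon U' p.2.1.1 hU' hKU' p.2.1.1.isCompact p.2.1.2 p.1 p.1.isCompact _ (by positivity) _
      (by positivity)
  choose A hAF hA using hex
  set f := Ultrafilter.of (atTop : Filter (TopologicalSpace.Compacts G ×
      {L : TopologicalSpace.Compacts (UnitSpace G) // (L : Set (UnitSpace G)) ⊆ V} × ℕ))
  have hf := Ultrafilter.of_le (atTop : Filter (TopologicalSpace.Compacts G ×
      {L : TopologicalSpace.Compacts (UnitSpace G) // (L : Set (UnitSpace G)) ⊆ V} × ℕ))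
  obtain ⟨μ, -, hμ⟩ := isCompact_univ.ultrafilter_le_nhds
    (f.map fun p => empiricalProb (A p) (hAF p).1) (by simp)
  have hμ : Tendsto (fun p => empiricalProb (A p) (hAF p).1) f (𝓝 μ) := hμ
  have hδ : Tendsto (fun p : TopologicalSpace.Compacts G ×
      {L : TopologicalSpace.Compacts (UnitSpace G) // (L : Set (UnitSpace G)) ⊆ V} × ℕ =>
      1 / ((p.2.2 : ℝ) + 1)) f (𝓝 0) := by
    refine Tendsto.mono_left ?_ hf
    have h1 : Tendsto (fun p : TopologicalSpace.Compacts G ×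
      {L : TopologicalSpace.Compacts (UnitSpace G) // (L : Set (UnitSpace G)) ⊆ V} × ℕ => p.2.2)
      atTop atTop := by
      rw [← prod_atTop_atTop_eq, ← prod_atTop_atTop_eq]
      exact tendsto_snd.comp tendsto_snd
    exact tendsto_one_div_add_atTop_nhds_zero_nat.comp h1
  have hδ0 : ∀ p : TopologicalSpace.Compacts G ×
      {L : TopologicalSpace.Compacts (UnitSpace G) // (L : Set (UnitSpace G)) ⊆ V} × ℕ,
      0 ≤ 1 / ((p.2.2 : ℝ) + 1) := fun p => by positivity
  have hmem : (μ : Measure (UnitSpace G)) ∈ invariantMeasures G := by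
    refine mem_invariantMeasures_of_le ht he fun Q hQ hr => ?_
    refine measure_le_of_hits_le (fun p => (hAF p).1) hμ hδ hδ0
      ((isLocalHomeomorph_src ht he).isOpenMap _ isOpen_interior)
      (hQ.image (continuous_rng he)).isClosed ?_
    filter_upwards [hf (eventually_ge_atTop (⟨Q, hQ⟩, ⟨⊥, by simp⟩, 0))] with p hp
    exact (hAF p).hits_src_le (show Q ⊆ p.1 from hp.1) hr interior_subset
  have hlt := hUV _ hmem
  obtain ⟨L, hLV, hL, hUL⟩ := hV.measurableSet.exists_lt_isCompact_of_ne_top (measure_ne_top _ _) hlt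
  obtain ⟨W, hW, hLW, hWV⟩ := normal_exists_closure_subset hL.isClosed hV hLV
  -- Eventually the compact set in the index contains `closure W`, so the failed inequality passes
  -- to the limit. This closes the cycle `μ U < μ L ≤ μ W ≤ μ (closure U') ≤ μ U`.
  have hle : (μ : Measure (UnitSpace G)) W ≤ (μ : Measure (UnitSpace G)) (closure U') := by
    refine measure_le_of_hits_le (fun p => (hAF p).1) hμ hδ hδ0 hW isClosed_closure ?_
    filter_upwards [hf (eventually_ge_atTop
      (⊥, ⟨⟨closure W, isClosed_closure.isCompact⟩, hWV⟩, 0))] with p hp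
    have h1 : W ⊆ p.2.1.1 := subset_closure.trans (show closure W ⊆ p.2.1.1 from hp.2.1)
    have h2 : (hits (A p) W : ℝ) ≤ hits (A p) p.2.1.1 := by exact_mod_cast hits_mono _ h1
    have h3 : (hits (A p) U' : ℝ) ≤ hits (A p) (closure U') := by
      exact_mod_cast hits_mono _ subset_closure
    linarith [hA p]
  exact absurd (hUL.trans_le (measure_mono hLW)) (not_lt.2 (hle.trans (measure_mono hU'U)))

end Measures

/-! ### Finite unit spaces, and absence of invariant measures. -/

section Conclusion

variable {G : Type u} [Gpd G] [TopologicalSpace G]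

/-- The uniform distribution on a finite unit space is invariant. -/
lemma uniform_mem_invariantMeasures [T2Space G] [Finite (UnitSpace G)] [Nonempty (UnitSpace G)] :
    (Measure.count (univ : Set (UnitSpace G)))⁻¹ • (Measure.count : Measure (UnitSpace G)) ∈
      invariantMeasures G := by
  have hfin : (Measure.count (univ : Set (UnitSpace G))) ≠ ⊤ :=
    (Measure.count_apply_lt_top.2 finite_univ).ne
  have hne : (Measure.count (univ : Set (UnitSpace G))) ≠ 0 := by
    simp
  have hp : IsProbabilityMeasure ((Measure.count (univ : Set (UnitSpace G)))⁻¹ •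
      (Measure.count : Measure (UnitSpace G))) := by
    constructor
    rw [Measure.smul_apply, smul_eq_mul, ENNReal.inv_mul_cancel hne hfin]
  refine ⟨hp, inferInstance, fun B _ hB => ?_⟩
  rw [Measure.smul_apply, Measure.smul_apply, Measure.count_apply (toFinite (rng '' B)).measurableSet,
    Measure.count_apply (toFinite (src '' B)).measurableSet, hB.injOn_src.encard_image,
    hB.injOn_rng.encard_image]

lemma isOpen_singleton_of_finite [T2Space G] [Finite (UnitSpace G)] (ht : IsTopologicalGpd G)
    (he : IsEtale G) (g : G) : IsOpen {g} := by
  obtain ⟨B, hB, hgB, hb⟩ := exists_bisection ht he g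
  have h1 : IsOpen (B ∩ src ⁻¹' {src g}) :=
    hB.inter ((isOpen_discrete {src g}).preimage (continuous_src ht he))
  convert h1
  ext x
  constructor
  · rintro rfl
    exact ⟨hgB, rfl⟩
  · rintro ⟨hx, hxg⟩
    exact hb.injOn_src hx hgB hxg

/-- The uniform measure turns the hypothesis into `|U| < |V|`. Minimality joins each point of `K` to
its image under an injection `K → V` by an arrow, and single arrows are open bisections. -/
lemma hasStrictComparison_of_finite [T2Space G] [Finite (UnitSpace G)] (ht : IsTopologicalGpd G)
    (he : IsEtale G) (hmin : IsMinimal G) : HasStrictComparison G := by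
  intro U V hU hV hVne h K hK hKU
  obtain ⟨v, hv⟩ := hVne
  have : Nonempty (UnitSpace G) := ⟨v⟩
  have hlt := h _ uniform_mem_invariantMeasures
  rw [Measure.smul_apply, Measure.smul_apply, Measure.count_apply (toFinite U).measurableSet,
    Measure.count_apply (toFinite V).measurableSet, smul_eq_mul, smul_eq_mul] at hlt
  have h1 : U.encard < V.encard := by
    have := lt_of_mul_lt_mul_left' hlt
    exact_mod_cast this
  obtain ⟨φ, hφ⟩ : ∃ φ : K → V, Function.Injective φ := by
    have h2 : K.encard ≤ V.encard := (encard_le_encard hKU).trans h1.le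
    obtain ⟨f, hf, hfi⟩ := (toFinite K).exists_injOn_of_encard_le h2
    exact ⟨fun k => ⟨f k, hf k.2⟩, fun k k' hkk => Subtype.ext (hfi k.2 k'.2 (congrArg Subtype.val hkk))⟩
  choose g hgs hgr using fun k : K => exists_src_eq_rng_mem ht he hmin
    (isOpen_discrete {(φ k : UnitSpace G)}) (singleton_nonempty _) k
  have := Fintype.ofFinite K
  refine compactSub_of_fintype (fun k => {g k}) (fun k => ?_) ?_ ?_ ?_
  · have := isOpen_singleton_of_finite ht he (g k)
    exact ⟨this, isBisection_of_injOn ht he this (injOn_singleton _ _) (injOn_singleton _ _)⟩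
  · intro k hk
    exact mem_iUnion.2 ⟨⟨k, hk⟩, g ⟨k, hk⟩, rfl, hgs _⟩
  · intro k k' hne
    rw [image_singleton, image_singleton, disjoint_singleton, hgr, hgr]
    exact fun h => hne (hφ (Subtype.ext h))
  · intro k
    rw [image_singleton, singleton_subset_iff, hgr]
    exact (φ k).2

lemma CompactSub.measure_le [T2Space G] {μ : Measure (UnitSpace G)} (hμ : μ ∈ invariantMeasures G)
    {K V : Set (UnitSpace G)} (h : CompactSub K V) : μ K ≤ μ V := by
  obtain ⟨n, A, hA, hK, hd, hV⟩ := h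
  have hm : ∀ i, MeasurableSet (rng '' A i) := by
    intro i
    obtain ⟨hAo, U, hU, hAU, hs, hr⟩ := hA i
    have h1 := hr.isOpenMap _ (hAo.preimage (continuous_subtype_val (p := (· ∈ U))))
    have h2 : U.domRestrict (rng : G → UnitSpace G) '' ((↑) ⁻¹' A i : Set U) = rng '' A i := by
      rw [show U.domRestrict (rng : G → UnitSpace G) = rng ∘ ((↑) : U → G) from rfl, image_comp,
        Subtype.image_preimage_coe, inter_eq_right.2 hAU]
    rw [← h2]
    exact h1.measurableSet
  calc μ K ≤ μ (⋃ i, src '' A i) := measure_mono hK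
    _ ≤ ∑ i, μ (src '' A i) := measure_iUnion_fintype_le _ _
    _ = ∑ i, μ (rng '' A i) := by
      refine Finset.sum_congr rfl fun i _ => (hμ.2.2 _ ?_ (hA i).2).symm
      exact MeasurableSpace.measurableSet_generateFrom (hA i).1
    _ = μ (⋃ i, rng '' A i) := by rw [measure_iUnion hd hm, tsum_fintype]
    _ ≤ μ V := measure_mono hV

/-- An invariant probability measure would give mass at least one to each of two disjoint open sets.
-/
lemma invariantMeasures_eq_empty [T2Space G] [CompactSpace (UnitSpace G)]
    [Nontrivial (UnitSpace G)]
    (h : ∀ O : Set (UnitSpace G), IsOpen O → O.Nonempty → CompactSub univ O) :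
    invariantMeasures G = ∅ := by
  refine eq_empty_of_forall_notMem fun μ hμ => ?_
  have := hμ.1
  obtain ⟨x, y, hxy⟩ := exists_pair_ne (UnitSpace G)
  obtain ⟨O, O', hO, hO', hx, hy, hd⟩ := t2_separation hxy
  have h1 := (h O hO ⟨x, hx⟩).measure_le hμ
  have h2 := (h O' hO' ⟨y, hy⟩).measure_le hμ
  have h3 : μ (O ∪ O') ≤ 1 := prob_le_one
  rw [measure_union hd hO'.measurableSet] at h3
  rw [measure_univ] at h1 h2
  have h4 := (add_le_add h1 h2).trans h3
  norm_num at h4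

end Conclusion

end EtaleGpd

open EtaleGpd in
theorem theorem5p15 {G : Type*} [EtaleGpd.Gpd G] [TopologicalSpace G]
    [LocallyCompactSpace G] [T2Space G]
    (htop : EtaleGpd.IsTopologicalGpd G) (hetale : EtaleGpd.IsEtale G)
    (hcompact : CompactSpace (EtaleGpd.UnitSpace G))
    (hmetr : TopologicalSpace.MetrizableSpace (EtaleGpd.UnitSpace G))
    (hmin : EtaleGpd.IsMinimal G) (hae : EtaleGpd.AlmostElementary G) :
    EtaleGpd.HasStrictComparison G ∧
      (Infinite (EtaleGpd.UnitSpace G) → ¬ EtaleGpd.FiberwiseAmenable G →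
        (∀ U O : Set (EtaleGpd.UnitSpace G), IsOpen U → IsOpen O → O.Nonempty →
          EtaleGpd.OpenSub U O) ∧
        EtaleGpd.invariantMeasures G = ∅) := by
  constructor
  · rcases finite_or_infinite (UnitSpace G) with hfin | hinf
    · exact hasStrictComparison_of_finite htop hetale hmin
    · intro U V hU hV hVne hUV K hK hKU
      obtain ⟨U', L, hU', hKU', hL, hLV, K₀, hK₀, ε, hε, δ, hδ, h⟩ :=
        exists_isFolner_hits_add_le htop hetale hU hV hUV hK hKU
      exact compactSub_of_isFolner_hits htop hetale hmin hae hK hV hVne hU' hKU' hL hLV hK₀ hε hδ h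
  · intro hinf hnot
    have key : ∀ K O : Set (UnitSpace G), IsCompact K → IsOpen O → O.Nonempty →
        CompactSub K O := by
      intro K O hK hO hOne
      simp only [FiberwiseAmenable] at hnot
      push Not at hnot
      obtain ⟨K₀, hK₀, ε, hε, h⟩ := hnot
      -- No `(K₀, ε)`-Følner sets exist, so the gap hypothesis holds vacuously, even with `U`
      -- everything, `L = ∅` and `δ = 1`.
      exact compactSub_of_isFolner_hits htop hetale hmin hae hK hO hOne isOpen_univ
        (subset_univ K) isCompact_empty (empty_subset O) hK₀ hε one_pos
        fun A hA => absurd hA (h A)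
    exact ⟨fun U O _ hO hOne K hK _ => key K O hK hO hOne,
      invariantMeasures_eq_empty fun O hO hOne => key univ O isCompact_univ hO hOne⟩
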